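/- Let $r$ be a prime power and $q=r^d$ with $d\ge 1$, so that $\mathbb F_r\subseteq\mathbb F_q$. Let $\mathbb F_q[x;r]$ be the set of $r$-additive polynomials $\sum_{0\le i\le n}a_ix^{r^i}$ with $a_i\in\mathbb F_q$, a ring under addition and composition. Its centre is $\mathbb F_r[x;q]=\{\sum_{0\le i\le n} a_ix^{q^i}: a_i\in\mathbb F_r\}$, which is isomorphic to $\mathbb F_r[y]$ via $\tau(\sum a_ix^{q^i})=\sum a_iy^i$. For nonzero $f\in\mathbb F_q[x;r]$ the minimal central left composition $f^*$ is the unique monic polynomial of least degree in $\mathbb F_r[x;q]$ of the form $f^*=g\circ f$ with $g\in\mathbb F_q[x;r]$. A decomposition of $f\in\mathbb F_q[x;r]$ in $\mathbb F_q[x;r]$ is a pair $(g,h)$ of elements of $\mathbb F_q[x;r]$ with $f=g\circ h$, $\deg g,\deg h\ge2$ and $h$ monic (then $g$ is monic if $f$ is). An $i$-collision of $f$ is a set of $i$ decompositions of $f$ in $\mathbb F_q[x;r]$ whose left components $g$ all have the same degree; it is maximal if it is not contained in an $(i+1)$-collision of $f$. For $i\in\mathbb N$ let $$C_i=\{(a,b)\in\mathbb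 F_q^2:\ x^{r^2}+ax^r+bx\text{ has a maximal }i\text{-collision in }\mathbb F_q[x;r]\},\qquad c_i=\#C_i,$$ and identify $(a,b)$ with the polynomial $x^{r^2}+ax^r+bx$. Then: - Case $0$: $C_0$ is the set of all monic $f\in\mathbb F_q[x;r]$ of degree $r^2$ such that $f^*$ has degree $q^2$ and cannot be written as $f^*=g^*\circ h^*$ with $g^*,h^*\in\mathbb F_r[x;q]$ of degree $q$; equivalently, such that $\tau(f^*)\in\mathbb F_r[y]$ is irreducible of degree $2$. Moreover $c_0=\dfrac{r(q^2-1)}{2(r+1)}$. - Case $1$: $C_1$ consists of $x^{r^2}$ and of all monic $f\in\mathbb F_q[x;r]$ of degree $r^2$ with $f^*=g^*\circ g^*$ for some $g^*=x^q-cx$, $c\in\mathbb F_r^\times$. Moreover $c_1=\dfrac{q^2-q}{r}+1$. - Case $2$: $C_2$ is the set of all monic $f\in\mathbb F_q[x;r]$ of degree $r^2$ with $f^*=g^*\circ h^*$ for some $g^*,h^*\in\mathbb F_r[x;q]$ of degree $q$ that are coprime in $\mathbb F_r[x;q]$ (that is, all their common right components in $\mathbb F_r[x;q]$ have degree $1$).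 Moreover $c_2=\dfrac{(q-1)^2(r-2)}{2(r-1)}+q-1$. - Case $r+1$: $C_{r+1}$ is the set of all monic $f\in\mathbb F_q[x;r]$ of degree $r^2$ with $f^*=x^q+cx$ for some $c\in\mathbb F_r^\times$. Moreover $c_{r+1}=\dfrac{(q-1)(q-r)}{r(r^2-1)}$. Finally $c_0+c_1+c_2+c_{r+1}=q^2$, and whenever a polynomial of degree $r^2$ in $\mathbb F_q[x;r]$ has a maximal $i$-collision in $\mathbb F_q[x;r]$, then $i\in\{0,1,2,r+1\}$. -/

import Mathlib

open Polynomial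

/-- The set `F[x; r]` of `r`-additive polynomials `∑_{0 ≤ i ≤ n} a_i x^{r^i}` with coefficients
in `F`, that is, the `F`-linear span of the powers `x^{r^i}`.
With `F = 𝔽_q` this is `𝔽_q[x; r]`; with `F = 𝔽_r` and exponent `q` it is `𝔽_r[x; q]`. -/
noncomputable def additivePolys (F : Type*) [Field F] (r : ℕ) : Submodule F F[X] :=
  Submodule.span F (Set.range fun i : ℕ => (X : F[X]) ^ (r ^ i))

/-- `(g, h)` is a (nontrivial, normalized) decomposition `f = g ∘ h` inside `F[x; r]`.
The right component is normalized to be monic; if `f` is monic, then so is `g`.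
Additive polynomials vanish at `0`, so `g` and `h` are original. -/
structure IsAdditiveDecomposition {F : Type*} [Field F] (r : ℕ) (f g h : F[X]) : Prop where
  left_mem : g ∈ additivePolys F r
  right_mem : h ∈ additivePolys F r
  right_monic : h.Monic
  left_degree : 2 ≤ g.natDegree
  right_degree : 2 ≤ h.natDegree
  comp_eq : g.comp h = f

/-- A finite set of decompositions of `f` in `F[x; r]` whose left components all have the same
degree.  If it has `i` elements, it is an (equal-degree) `i`-collision. -/
def IsCollision {F : Type*} [Field F] (r : ℕ) (f : F[X]) (S : Finset (F[X] × F[X])) : Prop :=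
  (∀ p ∈ S, IsAdditiveDecomposition r f p.1 p.2) ∧
    ∀ p ∈ S, ∀ p' ∈ S, p.1.natDegree = p'.1.natDegree

/-- `f` has a maximal `i`-collision in `F[x; r]`: an `i`-collision that is not contained in an
`(i+1)`-collision. -/
def HasMaximalCollision {F : Type*} [Field F] (r : ℕ) (f : F[X]) (i : ℕ) : Prop :=
  ∃ S : Finset (F[X] × F[X]), IsCollision r f S ∧ S.card = i ∧
    ¬ ∃ S' : Finset (F[X] × F[X]), IsCollision r f S' ∧ S'.card = i + 1 ∧ S ⊆ S'

/-- The trinomial `x^{r^2} + a x^r + b x` with `ab = (a, b)`. -/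
noncomputable def additiveTrinomial {F : Type*} [Field F] (r : ℕ) (ab : F × F) : F[X] :=
  X ^ (r ^ 2) + C ab.1 * X ^ r + C ab.2 * X

/-- The set `C_i` of all `(a, b)` for which `x^{r^2} + a x^r + b x` has a maximal
`i`-collision in `F[x; r]`. -/
def collisionSet (F : Type*) [Field F] (r i : ℕ) : Set (F × F) :=
  {ab | HasMaximalCollision r (additiveTrinomial r ab) i}

/-- The monic polynomials of degree `r^2` in `F[x; r]`. -/
def monicAdditiveSq (F : Type*) [Field F] (r : ℕ) : Set F[X] :=
  {f | f ∈ additivePolys F r ∧ f.Monic ∧ f.natDegree = r ^ 2}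

/-- The map `τ : 𝔽_r[x; q] → 𝔽_r[y]`, `∑ a_i x^{q^i} ↦ ∑ a_i y^i`. -/
noncomputable def tau {K : Type*} [Field K] (q : ℕ) (f : K[X]) : K[X] :=
  ∑ i ∈ Finset.range (f.natDegree + 1), C (f.coeff (q ^ i)) * X ^ i

/-- Coprimality in the ring `K[x; q]` (addition and composition; the units are `c x` with
`c ≠ 0`): every common right component in `K[x; q]` has degree `1`. -/
def IsCompCoprime {K : Type*} [Field K] (q : ℕ) (g h : K[X]) : Prop :=
  ∀ u ∈ additivePolys K q, ∀ v ∈ additivePolys K q, ∀ w ∈ additivePolys K q,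
    g = v.comp u → h = w.comp u → u.natDegree = 1

/-- With `r = #K` and `q = #L`: `F ∈ K[x; q]` is monic, and `F = g ∘ f` for some
`g ∈ L[x; r]`. -/
structure IsCentralLeftComposition {K L : Type*} [Field K] [Field L] [Algebra K L]
    (f : L[X]) (F : K[X]) : Prop where
  central : F ∈ additivePolys K (Nat.card L)
  monic : F.Monic
  exists_comp : ∃ g ∈ additivePolys L (Nat.card K), F.map (algebraMap K L) = g.comp f

/-- `F` is a monic central left composition of `f` of minimal degree. -/
def IsMinimalCentralLeftComposition {K L : Type*} [Field K] [Field L] [Algebra K L]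
    (f : L[X]) (F : K[X]) : Prop :=
  IsCentralLeftComposition f F ∧
    ∀ G : K[X], IsCentralLeftComposition f G → F.natDegree ≤ G.natDegree

open Classical in
/-- The minimal central left composition `f^*` of a nonzero `f ∈ L[x; r]`, as an element of
`K[x; q]`, where `r = #K` and `q = #L`.  It exists and is unique, see `mclc_spec` and
`mclc_unique`. -/
noncomputable def mclc (K : Type*) {L : Type*} [Field K] [Field L] [Algebra K L] (f : L[X]) :
    K[X] :=
  if h : ∃ F : K[X], IsMinimalCentralLeftComposition f F then h.choose else 0

section MCLCExists

theorem additivePolys_coeff {F : Type*} [Field F] {r : ℕ} {f : F[X]}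
    (hf : f ∈ additivePolys F r) (k : ℕ) (hk : f.coeff k ≠ 0) : ∃ i, k = r ^ i := by
  by_contra hcon
  push Not at hcon
  apply hk
  induction hf using Submodule.span_induction with
  | mem x hx =>
    obtain ⟨i, rfl⟩ := hx
    simp [coeff_X_pow, hcon i]
  | zero => simp
  | add x y _ _ hx hy =>
    rw [coeff_add]
    by_cases h1 : x.coeff k = 0
    · by_cases h2 : y.coeff k = 0
      · rw [h1, h2, add_zero]
      · exact absurd (hy h2) h2
    · exact absurd (hx h1) h1
  | smul a x _ hx =>
    rw [coeff_smul]
    by_cases h1 : x.coeff k = 0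
    · rw [h1, smul_zero]
    · exact absurd (hx h1) h1

theorem additivePolys_natDegree {F : Type*} [Field F] {r : ℕ} {f : F[X]}
    (hf : f ∈ additivePolys F r) (h0 : f ≠ 0) : ∃ i, f.natDegree = r ^ i :=
  additivePolys_coeff hf _ (by simpa using h0)

theorem additivePolys_pow {F : Type*} [Field F] {p e : ℕ} [Fact p.Prime] [CharP F p] {f : F[X]}
    (hf : f ∈ additivePolys F (p ^ e)) (k : ℕ) :
    f ^ ((p ^ e) ^ k) ∈ additivePolys F (p ^ e) := by
  have hp : p.Prime := Fact.out
  induction hf using Submodule.span_induction with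
  | mem x hx =>
    obtain ⟨i, rfl⟩ := hx
    refine Submodule.subset_span ⟨i + k, ?_⟩
    simp only [← pow_mul, ← pow_add, Nat.mul_add]
  | zero =>
    rw [zero_pow (pow_ne_zero _ (pow_ne_zero _ hp.ne_zero))]
    exact Submodule.zero_mem _
  | add x y _ _ hx hy =>
    rw [← pow_mul, add_pow_char_pow, pow_mul]
    exact Submodule.add_mem _ hx hy
  | smul a x _ hx =>
    rw [_root_.smul_pow]
    exact Submodule.smul_mem _ _ hx

theorem additivePolys_divide {F : Type*} [Field F] {p e : ℕ} [Fact p.Prime] [CharP F p]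
    (he : e ≠ 0) {f : F[X]} (hf : f ∈ additivePolys F (p ^ e)) (h0 : f ≠ 0) (N : ℕ) :
    ∀ P ∈ additivePolys F (p ^ e), P.natDegree < N →
      ∃ g ∈ additivePolys F (p ^ e), (P - g.comp f).degree < f.degree := by
  have hp : p.Prime := Fact.out
  induction N with
  | zero => intro P _ h; omega
  | succ N ih =>
    intro P hP hN
    by_cases hlt : P.degree < f.degree
    · exact ⟨0, Submodule.zero_mem _, by simpa using hlt⟩
    have hP0 : P ≠ 0 := by
      rintro rfl
      exact hlt (by simpa [bot_lt_iff_ne_bot, degree_eq_bot] using h0)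
    obtain ⟨n, hn⟩ := additivePolys_natDegree hf h0
    obtain ⟨M, hM⟩ := additivePolys_natDegree hP hP0
    have hle : f.natDegree ≤ P.natDegree := natDegree_le_natDegree (not_lt.mp hlt)
    have hr : 1 < p ^ e := Nat.one_lt_pow he hp.one_lt
    have hnM : n ≤ M := by
      rw [hn, hM] at hle
      exact (Nat.pow_le_pow_iff_right hr).mp hle
    set c : F := P.leadingCoeff / f.leadingCoeff ^ ((p ^ e) ^ (M - n)) with hc
    have hlf : f.leadingCoeff ^ ((p ^ e) ^ (M - n)) ≠ 0 :=
      pow_ne_zero _ (leadingCoeff_ne_zero.mpr h0)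
    have hc0 : c ≠ 0 := div_ne_zero (leadingCoeff_ne_zero.mpr hP0) hlf
    set Q : F[X] := c • X ^ ((p ^ e) ^ (M - n)) with hQ
    have hQmem : Q ∈ additivePolys F (p ^ e) :=
      Submodule.smul_mem _ _ (Submodule.subset_span ⟨M - n, rfl⟩)
    have hcomp : Q.comp f = c • f ^ ((p ^ e) ^ (M - n)) := by
      rw [hQ, smul_comp, pow_comp, X_comp]
    have hdeg : (Q.comp f).natDegree = P.natDegree := by
      rw [hcomp, natDegree_smul _ hc0, natDegree_pow, hn, hM, ← pow_add, Nat.sub_add_cancel hnM]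
    have hlead : (Q.comp f).leadingCoeff = P.leadingCoeff := by
      rw [hcomp, leadingCoeff_smul_of_smul_regular _ (IsSMulRegular.of_ne_zero hc0),
        leadingCoeff_pow, hc, smul_eq_mul, div_mul_cancel₀ _ hlf]
    have hcomp0 : Q.comp f ≠ 0 := by
      rw [← leadingCoeff_ne_zero, hlead]; exact leadingCoeff_ne_zero.mpr hP0
    have hmem : P - Q.comp f ∈ additivePolys F (p ^ e) := by
      rw [hcomp]
      exact Submodule.sub_mem _ hP (Submodule.smul_mem _ _ (additivePolys_pow hf _))
    have hsub : (P - Q.comp f).degree < P.degree :=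
      degree_sub_lt_left (by rw [degree_eq_natDegree hP0, degree_eq_natDegree hcomp0, hdeg]) hP0 hlead.symm
    by_cases hz : P - Q.comp f = 0
    · exact ⟨Q, hQmem, by simpa [hz, bot_lt_iff_ne_bot, degree_eq_bot] using h0⟩
    · obtain ⟨g, hg, hgl⟩ := ih _ hmem (by
        have := natDegree_lt_natDegree hz hsub
        omega)
      refine ⟨Q + g, Submodule.add_mem _ hQmem hg, ?_⟩
      rwa [add_comp, ← sub_sub]

variable {K L : Type*} [Field K] [Field L] [Algebra K L]

theorem exists_centralLeftComposition [Finite K] [Finite L] {f : L[X]}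
    (hf : f ∈ additivePolys L (Nat.card K)) (h0 : f ≠ 0) :
    ∃ F : K[X], IsCentralLeftComposition f F := by
  have := Fintype.ofFinite K
  have := Fintype.ofFinite L
  obtain ⟨p, hpK, e, hp, hcard⟩ := FiniteField.card' K
  have : Fact p.Prime := ⟨hp⟩
  have : CharP L p := charP_of_injective_algebraMap (algebraMap K L).injective p
  have hq : Nat.card L = Nat.card K ^ Module.finrank K L := Module.natCard_eq_pow_finrank
  have hr : Nat.card K = p ^ (e : ℕ) := by rw [Nat.card_eq_fintype_card, hcard]
  have hq1 : 1 < Nat.card L := Finite.one_lt_card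
  have key : ∀ i : ℕ, ∃ g ∈ additivePolys L (Nat.card K),
      (X ^ (Nat.card L ^ i) - g.comp f).degree < f.degree := by
    intro i
    rw [hr] at hf ⊢
    refine additivePolys_divide e.ne_zero hf h0 _ _ ?_ (Nat.lt_succ_self _)
    refine Submodule.subset_span ⟨Module.finrank K L * i, ?_⟩
    simp only [hq, hr, ← pow_mul, mul_assoc]
  choose g hg hlt using key
  have hfin : Finite (degreeLT L f.natDegree) :=
    Finite.of_equiv _ (degreeLTEquiv L f.natDegree).toEquiv.symm
  obtain ⟨i, j, hij, heq⟩ := Finite.exists_ne_map_eq_of_infinite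
    (fun i : ℕ => (⟨X ^ (Nat.card L ^ i) - (g i).comp f, by
      rw [mem_degreeLT, ← degree_eq_natDegree h0]; exact hlt i⟩ : degreeLT L f.natDegree))
  have heq' : (X : L[X]) ^ (Nat.card L ^ i) - (g i).comp f
      = X ^ (Nat.card L ^ j) - (g j).comp f := congrArg Subtype.val heq
  have main : ∀ a b : ℕ, a < b → (X : L[X]) ^ (Nat.card L ^ a) - (g a).comp f
      = X ^ (Nat.card L ^ b) - (g b).comp f → ∃ F : K[X], IsCentralLeftComposition f F := by
    intro a b hab h
    refine ⟨X ^ (Nat.card L ^ b) - X ^ (Nat.card L ^ a), ?_, ?_, g b - g a,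
      Submodule.sub_mem _ (hg b) (hg a), ?_⟩
    · exact Submodule.sub_mem _ (Submodule.subset_span ⟨b, rfl⟩) (Submodule.subset_span ⟨a, rfl⟩)
    · refine monic_X_pow_sub ?_
      rw [degree_X_pow]
      exact_mod_cast Nat.pow_lt_pow_right hq1 hab
    · rw [sub_comp]
      simp only [Polynomial.map_sub, Polynomial.map_pow, map_X]
      linear_combination -h
  rcases lt_or_gt_of_ne hij with h | h
  · exact main i j h heq'
  · exact main j i h heq'.symm

theorem mclc_spec [Finite K] [Finite L] {f : L[X]}
    (hf : f ∈ additivePolys L (Nat.card K)) (h0 : f ≠ 0) :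
    IsMinimalCentralLeftComposition f (mclc K f) := by
  classical
  have hex : ∃ n, ∃ F : K[X], IsCentralLeftComposition f F ∧ F.natDegree = n := by
    obtain ⟨F, hF⟩ := exists_centralLeftComposition (K := K) hf h0
    exact ⟨_, F, hF, rfl⟩
  obtain ⟨F, hF, hn⟩ := Nat.find_spec hex
  have h : ∃ F : K[X], IsMinimalCentralLeftComposition f F :=
    ⟨F, hF, fun G hG => hn ▸ Nat.find_min' hex ⟨G, hG, rfl⟩⟩
  rw [mclc, dif_pos h]
  exact h.choose_spec

theorem mclc_unique {f : L[X]} {F : K[X]} (hF : IsMinimalCentralLeftComposition f F) :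
    F = mclc K f := by
  classical
  have h : ∃ F : K[X], IsMinimalCentralLeftComposition f F := ⟨F, hF⟩
  rw [mclc, dif_pos h]
  generalize hG' : h.choose = G
  have hG : IsMinimalCentralLeftComposition f G := hG' ▸ h.choose_spec
  by_contra hne
  have hD : F - G ≠ 0 := sub_ne_zero.mpr hne
  have hdeg : F.natDegree = G.natDegree := le_antisymm (hF.2 _ hG.1) (hG.2 _ hF.1)
  have hlt : (F - G).degree < F.degree :=
    degree_sub_lt_left (by rw [degree_eq_natDegree hF.1.monic.ne_zero,
      degree_eq_natDegree hG.1.monic.ne_zero, hdeg]) hF.1.monic.ne_zero (by rw [hF.1.monic, hG.1.monic])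
  obtain ⟨u, hu, hu'⟩ := hF.1.exists_comp
  obtain ⟨v, hv, hv'⟩ := hG.1.exists_comp
  have hl : (F - G).leadingCoeff⁻¹ ≠ 0 := inv_ne_zero (leadingCoeff_ne_zero.mpr hD)
  have := hF.2 ((F - G).leadingCoeff⁻¹ • (F - G)) ⟨
    Submodule.smul_mem _ _ (Submodule.sub_mem _ hF.1.central hG.1.central), by
      rw [smul_eq_C_mul, mul_comm]; exact monic_mul_leadingCoeff_inv hD,
    algebraMap K L (F - G).leadingCoeff⁻¹ • (u - v),
    Submodule.smul_mem _ _ (Submodule.sub_mem _ hu hv), by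
      rw [smul_comp, sub_comp, Polynomial.map_smul, Polynomial.map_sub, hu', hv']⟩
  rw [natDegree_smul _ hl] at this
  have := natDegree_lt_natDegree hD hlt
  omega

end MCLCExists

/-! Write f = x^{r^2} + ax^r + bx. Degrees multiply under composition, so every decomposition of f
has a right component x^r - ux, and the possible u are exactly the roots of u^{r+1} + au + b, the
slopes of f. All decompositions together form one collision, so the maximal collision size is the
number of slopes (`hasMaximalCollision_iff`). Fix a slope u with left component x^r - vx. The
substitution w = u + 1/s turns the equation for the other slopes w into v s^r - us = 1, which is
affine over F_r with a kernel of dimension at most 1 whenever it is solvable. It has 0, 1 or r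
solutions, so f has 0, 1, 2 or r+1 slopes (`card_slopes_cases`).

The c_i come from double counting over the pairs (u, v): the numbers of pairs, of solutions s, and
of ordered pairs of distinct solutions give three linear equations. The fourth is the total q^2 of
the pairs (a, b) (`slopeCount_formulas`).

For f^*, the relation x^r = ux implies x^q = N(u)x, with N the norm from F_q to F_r. Hence f divides
(x^q - N(u)x) ∘ (x^q - N(v)x). If u' is another slope, then N(v) = N(u'); with three slopes all
norms agree, and f divides some x^q - cx. Conversely, if b ≠ 0 and f divides x^q - cx, each of the
r^2 - 1 nonzero roots x of f yields the slope x^{r-1}, which forces at least r+1 slopes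
(`le_card_slopes_of_dvd`). Without slopes, Cayley–Hamilton for x ↦ x^q on the 2-dimensional
F_r-space of roots of f gives a central multiple of degree q^2; a root of the characteristic
polynomial would give an eigenvector, hence a slope (`exists_quadratic_multiple`). Apart from f =
x^{r^2}, the number of slopes thus fixes the shape of f^*, and these shapes exclude one another,
which gives the converses (`trinomial_cases`). -/

set_option linter.unusedSectionVars false

/-! ### Power maps and norms in algebras over finite fields -/

section Frobenius

variable {K L : Type*} [Field K] [Finite K] [Field L] [Finite L] [Algebra K L]

/-- Stated for arbitrary K-algebras, because it is applied to fields, to polynomial rings and to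
quotients L[x]/(f) that need not be reduced. -/
theorem add_pow_natCard (K : Type*) [Field K] [Finite K] {A : Type*} [CommRing A] [Algebra K A]
    (x y : A) : (x + y) ^ Nat.card K = x ^ Nat.card K + y ^ Nat.card K := by
  have := Fintype.ofFinite K
  simpa [Nat.card_eq_fintype_card] using map_add (FiniteField.frobeniusAlgHom K A) x y

theorem sub_pow_natCard (K : Type*) [Field K] [Finite K] {A : Type*} [CommRing A] [Algebra K A]
    (x y : A) : (x - y) ^ Nat.card K = x ^ Nat.card K - y ^ Nat.card K := by
  have := Fintype.ofFinite K
  simpa [Nat.card_eq_fintype_card] using map_sub (FiniteField.frobeniusAlgHom K A) x y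

theorem pow_natCard_self (c : K) : c ^ Nat.card K = c := by
  have := Fintype.ofFinite K
  rw [Nat.card_eq_fintype_card, FiniteField.pow_card]

theorem algebraMap_pow_natCard {A : Type*} [CommRing A] [Algebra K A] (c : K) :
    algebraMap K A c ^ Nat.card K = algebraMap K A c := by
  rw [← map_pow, pow_natCard_self]

/-- The norm of `u` over `K`, as an element of `L`. -/
noncomputable def embeddedNorm (K : Type*) {L : Type*} [Field K] [Field L] [Algebra K L] (u : L) :
    L := algebraMap K L (Algebra.norm K u)

theorem embeddedNorm_pow_natCard (u : L) : embeddedNorm K u ^ Nat.card K = embeddedNorm K u :=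
  algebraMap_pow_natCard _

/-- N(s) is a unit of K, so its (r-1)-st power is 1. -/
theorem embeddedNorm_pow_mul {s : L} (hs : s ≠ 0) (u : L) :
    embeddedNorm K (s ^ (Nat.card K - 1) * u) = embeddedNorm K u := by
  have := Fintype.ofFinite K
  have h : Algebra.norm K s ≠ 0 := fun h => hs (Algebra.norm_eq_zero_iff.mp h)
  rw [embeddedNorm, map_mul, map_pow, Nat.card_eq_fintype_card,
    FiniteField.pow_card_sub_one_eq_one _ h, one_mul, embeddedNorm]

/-- Iterating x^r = ux gives x^{r^k} = u^{1 + r + ... + r^{k-1}} x; for k = [L : K] the exponent of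
x is q and the factor is the norm of u. -/
theorem pow_natCard_eq_norm_mul {A : Type*} [CommRing A] [Algebra L A] {u : L} {x : A}
    (h : x ^ Nat.card K = algebraMap L A u * x) :
    x ^ Nat.card L = algebraMap L A (embeddedNorm K u) * x := by
  have key : ∀ k : ℕ, x ^ (Nat.card K ^ k) =
      algebraMap L A (∏ i ∈ Finset.range k, u ^ (Nat.card K ^ i)) * x := by
    intro k
    induction k with
    | zero => simp
    | succ k ih =>
      rw [pow_succ', pow_mul, h, mul_pow, ih, Finset.prod_range_succ, map_mul, map_pow]
      ring
  rw [embeddedNorm, FiniteField.algebraMap_norm_eq_prod_pow, ← key,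
    ← Module.natCard_eq_pow_finrank]

/-- With y = x^r - ux the hypothesis reads y^r = vy, so y^q = N(v)y. The operators x ↦ x^r - ux and
x ↦ x^q - N(v)x commute, since N(v)^r = N(v) and u^q = u; hence z = x^q - N(v)x satisfies z^r = uz,
and so z^q = N(u)z. -/
theorem trinomial_eq_zero_norm {A : Type*} [CommRing A] [Algebra K A] [Algebra L A]
    {u v : L} {x : A}
    (h : x ^ (Nat.card K ^ 2) + algebraMap L A (-u ^ Nat.card K - v) * x ^ Nat.card K
      + algebraMap L A (u * v) * x = 0) :
    x ^ (Nat.card L ^ 2)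
      - algebraMap L A (embeddedNorm K u + embeddedNorm K v) * x ^ Nat.card L
      + algebraMap L A (embeddedNorm K u * embeddedNorm K v) * x = 0 := by
  set U := algebraMap L A u with hU
  have hcu := algebraMap_pow_natCard (A := A) u
  set y := x ^ Nat.card K - U * x with hy
  have h1 : y ^ Nat.card K = algebraMap L A v * y := by
    rw [hy, sub_pow_natCard K, mul_pow, ← pow_mul, ← sq]
    simp only [map_sub, map_neg, map_mul, map_pow, ← hU] at h
    linear_combination h
  have h2 := pow_natCard_eq_norm_mul h1
  set z := x ^ Nat.card L - algebraMap L A (embeddedNorm K v) * x with hz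
  have h3 : z ^ Nat.card K = U * z := by
    rw [hz, sub_pow_natCard K, mul_pow, ← map_pow, embeddedNorm_pow_natCard]
    have h4 : y ^ Nat.card L = (x ^ Nat.card L) ^ Nat.card K - U * x ^ Nat.card L := by
      rw [hy, sub_pow_natCard L, mul_pow, hcu, ← pow_mul, ← pow_mul, mul_comm (Nat.card K)]
    linear_combination h2 - h4 + algebraMap L A (embeddedNorm K v) * hy
  have h5 := pow_natCard_eq_norm_mul h3
  have h6 : z ^ Nat.card L = x ^ (Nat.card L ^ 2)
      - algebraMap L A (embeddedNorm K v) * x ^ Nat.card L := by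
    rw [hz, sub_pow_natCard L, mul_pow, algebraMap_pow_natCard, ← pow_mul, ← sq]
  simp only [map_add, map_mul]
  linear_combination h5 - h6 + algebraMap L A (embeddedNorm K u) * hz

/-- Put w = x^q - cx. The two factorizations give w^r = uw and w^r = u'w, and u - u' is a unit, so w
= 0. -/
theorem trinomial_eq_zero_linear {A : Type*} [CommRing A] [Algebra K A] [Algebra L A]
    {u v u' v' c : L} {x : A}
    (h : x ^ (Nat.card K ^ 2) + algebraMap L A (-u ^ Nat.card K - v) * x ^ Nat.card K
      + algebraMap L A (u * v) * x = 0)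
    (ha : -u ^ Nat.card K - v = -u' ^ Nat.card K - v') (hb : u * v = u' * v') (hne : u ≠ u')
    (hv : embeddedNorm K v = c) (hv' : embeddedNorm K v' = c) :
    x ^ Nat.card L = algebraMap L A c * x := by
  have key : ∀ u v : L, x ^ (Nat.card K ^ 2) +
      algebraMap L A (-u ^ Nat.card K - v) * x ^ Nat.card K + algebraMap L A (u * v) * x = 0 →
      embeddedNorm K v = c →
      (x ^ Nat.card K - algebraMap L A u * x) ^ Nat.card L =
        algebraMap L A c * (x ^ Nat.card K - algebraMap L A u * x) := by
    rintro u v h rfl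
    apply pow_natCard_eq_norm_mul
    rw [sub_pow_natCard K, mul_pow, ← pow_mul, ← sq]
    simp only [map_sub, map_neg, map_mul, map_pow] at h
    linear_combination h
  have e1 := key u v h hv
  have e2 := key u' v' (by rw [← ha, ← hb]; exact h) hv'
  rw [sub_pow_natCard L, mul_pow, algebraMap_pow_natCard] at e1 e2
  have hi : algebraMap L A (u - u')⁻¹ * (algebraMap L A u - algebraMap L A u') = 1 := by
    rw [← map_sub, ← map_mul, inv_mul_cancel₀ (sub_ne_zero.mpr hne), map_one]
  linear_combination algebraMap L A (u - u')⁻¹ * (e2 - e1)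
    - (x ^ Nat.card L - algebraMap L A c * x) * hi

/-- If `x^r - u x` and `x^r - u' x` are distinct right components of the same trinomial, then the
left component `x^r - v x` belonging to `u` satisfies `N(v) = N(u')`. -/
theorem embeddedNorm_left_factor {u v u' v' : L} (hne : u ≠ u')
    (ha : -u ^ Nat.card K - v = -u' ^ Nat.card K - v') (hb : u * v = u' * v') :
    embeddedNorm K v = embeddedNorm K u' := by
  have hd : u' - u ≠ 0 := sub_ne_zero.mpr hne.symm
  have h := sub_pow_natCard K u' u
  -- Additivity turns the first relation into (u' - u)^r = v - v'; multiplying by u' and using u'v'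
  -- = uv gives u'(u' - u)^r = (u' - u)v.
  have h1 : v = (u' - u) ^ (Nat.card K - 1) * u' := by
    apply mul_left_cancel₀ hd
    have : (u' - u) ^ Nat.card K = (u' - u) ^ (Nat.card K - 1) * (u' - u) := by
      rw [← pow_succ, Nat.sub_add_cancel Nat.card_pos]
    linear_combination -hb - u' * ha + u' * this - u' * h
  rw [h1, embeddedNorm_pow_mul hd]

/-- Elements fixed by the `q`-th power map lie in the field with `q` elements. -/
theorem exists_algebraMap_of_pow_natCard {M : Type*} [Field M] [Algebra L M] {x : M}
    (h : x ^ Nat.card L = x) : ∃ u : L, algebraMap L M u = x := by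
  have := Fintype.ofFinite L
  have hq : 1 < Fintype.card L := Fintype.one_lt_card
  have hr := FiniteField.roots_X_pow_card_sub_X L
  -- All q roots of X^q - X already lie in L, so the extension M contributes no further ones.
  have hs : Splits (X ^ Fintype.card L - X : L[X]) := by
    rw [splits_iff_card_roots, hr, FiniteField.X_pow_card_sub_X_natDegree_eq L hq]
    rfl
  have hx : x ∈ ((X ^ Fintype.card L - X : L[X]).map (algebraMap L M)).roots := by
    rw [mem_roots (map_ne_zero (FiniteField.X_pow_card_sub_X_ne_zero L hq))]
    rw [Nat.card_eq_fintype_card] at h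
    simp [h]
  rw [hs.roots_map] at hx
  obtain ⟨u, -, hu⟩ := Multiset.mem_map.mp hx
  exact ⟨u, hu⟩

end Frobenius

/-! ### Additive polynomials of degree at most m^2 -/

section AdditivePolynomials

/-- The additive polynomial `α x^{m^2} + β x^m + γ x`. -/
noncomputable def additiveQuad {F : Type*} [Field F] (m : ℕ) (α β γ : F) : F[X] :=
  C α * X ^ (m ^ 2) + C β * X ^ m + C γ * X

variable {F : Type*} [Field F] {m : ℕ}

theorem additiveTrinomial_eq (ab : F × F) :
    additiveTrinomial m ab = additiveQuad m 1 ab.1 ab.2 := by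
  simp [additiveTrinomial, additiveQuad]

theorem pow_mem_additivePolys (i : ℕ) : (X : F[X]) ^ (m ^ i) ∈ additivePolys F m :=
  Submodule.subset_span ⟨i, rfl⟩

theorem additiveQuad_mem (α β γ : F) : additiveQuad m α β γ ∈ additivePolys F m := by
  have h0 := pow_mem_additivePolys (F := F) (m := m) 0
  have h1 := pow_mem_additivePolys (F := F) (m := m) 1
  rw [pow_zero, pow_one] at h0
  rw [pow_one] at h1
  simp only [additiveQuad, ← smul_eq_C_mul]
  exact add_mem (add_mem (Submodule.smul_mem _ _ (pow_mem_additivePolys 2))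
    (Submodule.smul_mem _ _ h1)) (Submodule.smul_mem _ _ h0)

theorem additiveQuad_coeff_sq (hm : 1 < m) (α β γ : F) :
    (additiveQuad m α β γ).coeff (m ^ 2) = α := by
  have h1 : m ^ 2 ≠ m := by nlinarith
  have h2 : 1 ≠ m ^ 2 := by nlinarith
  simp [additiveQuad, coeff_X_pow, coeff_X, h1, h2]

theorem additiveQuad_coeff_self (hm : 1 < m) (α β γ : F) :
    (additiveQuad m α β γ).coeff m = β := by
  have h1 : m ≠ m ^ 2 := by nlinarith
  have h2 : 1 ≠ m := by omega
  simp [additiveQuad, coeff_X_pow, coeff_X, h1, h2]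

theorem additiveQuad_coeff_one (hm : 1 < m) (α β γ : F) :
    (additiveQuad m α β γ).coeff 1 = γ := by
  have h1 : 1 ≠ m := by omega
  have h2 : 1 ≠ m ^ 2 := by nlinarith
  simp [additiveQuad, coeff_X_pow, h1, h2]

theorem additiveQuad_inj (hm : 1 < m) {α β γ α' β' γ' : F} :
    additiveQuad m α β γ = additiveQuad m α' β' γ' ↔ α = α' ∧ β = β' ∧ γ = γ' := by
  refine ⟨fun h => ⟨?_, ?_, ?_⟩, by rintro ⟨rfl, rfl, rfl⟩; rfl⟩
  · rw [← additiveQuad_coeff_sq hm α β γ, h, additiveQuad_coeff_sq hm]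
  · rw [← additiveQuad_coeff_self hm α β γ, h, additiveQuad_coeff_self hm]
  · rw [← additiveQuad_coeff_one hm α β γ, h, additiveQuad_coeff_one hm]

theorem additiveQuad_natDegree_le (hm : 1 < m) (α β γ : F) :
    (additiveQuad m α β γ).natDegree ≤ m ^ 2 := by
  have h1 : m ≤ m ^ 2 := by nlinarith
  have h2 : 1 ≤ m ^ 2 := by nlinarith
  refine natDegree_add_le_of_degree_le (natDegree_add_le_of_degree_le ?_ ?_) ?_
  · exact natDegree_C_mul_X_pow_le _ _
  · exact (natDegree_C_mul_X_pow_le _ _).trans h1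
  · exact (natDegree_C_mul_le _ _).trans (natDegree_X_le.trans h2)

theorem additiveQuad_natDegree (hm : 1 < m) {α : F} (hα : α ≠ 0) (β γ : F) :
    (additiveQuad m α β γ).natDegree = m ^ 2 := by
  apply natDegree_eq_of_le_of_coeff_ne_zero
  · exact additiveQuad_natDegree_le hm _ _ _
  · rwa [additiveQuad_coeff_sq hm]

theorem additiveQuad_natDegree_zero (hm : 1 < m) {β : F} (hβ : β ≠ 0) (γ : F) :
    (additiveQuad m 0 β γ).natDegree = m := by
  apply natDegree_eq_of_le_of_coeff_ne_zero
  · simp only [additiveQuad, C_0, zero_mul, zero_add]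
    refine natDegree_add_le_of_degree_le ?_ ?_
    · exact natDegree_C_mul_X_pow_le _ _
    · exact (natDegree_C_mul_le _ _).trans (natDegree_X_le.trans hm.le)
  · rwa [additiveQuad_coeff_self hm]

theorem additiveQuad_monic (hm : 1 < m) (β γ : F) : (additiveQuad m 1 β γ).Monic := by
  rw [Monic, leadingCoeff, additiveQuad_natDegree hm one_ne_zero, additiveQuad_coeff_sq hm]

theorem additiveQuad_monic_zero (hm : 1 < m) (γ : F) : (additiveQuad m 0 1 γ).Monic := by
  rw [Monic, leadingCoeff, additiveQuad_natDegree_zero hm one_ne_zero, additiveQuad_coeff_self hm]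

theorem eq_additiveQuad (hm : 1 < m) {f : F[X]} (hf : f ∈ additivePolys F m)
    (hd : f.natDegree ≤ m ^ 2) :
    f = additiveQuad m (f.coeff (m ^ 2)) (f.coeff m) (f.coeff 1) := by
  ext k
  by_cases hk : ∃ i, i ≤ 2 ∧ k = m ^ i
  · obtain ⟨i, hi, rfl⟩ := hk
    interval_cases i
    · simp only [pow_zero]
      rw [additiveQuad_coeff_one hm]
    · simp only [pow_one]
      rw [additiveQuad_coeff_self hm]
    · rw [additiveQuad_coeff_sq hm]
  · have key : ∀ g ∈ additivePolys F m, g.natDegree ≤ m ^ 2 → g.coeff k = 0 := by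
      intro g hg hgd
      by_contra h0
      obtain ⟨i, rfl⟩ := additivePolys_coeff hg k h0
      refine hk ⟨i, ?_, rfl⟩
      exact (Nat.pow_le_pow_iff_right hm).mp ((le_natDegree_of_ne_zero h0).trans hgd)
    rw [key f hf hd, key _ (additiveQuad_mem _ _ _) (additiveQuad_natDegree_le hm _ _ _)]

theorem eq_additiveQuad_of_natDegree_sq (hm : 1 < m) {f : F[X]} (hf : f ∈ additivePolys F m)
    (hd : f.natDegree = m ^ 2) : ∃ α β γ, α ≠ 0 ∧ f = additiveQuad m α β γ := by
  refine ⟨_, _, _, ?_, eq_additiveQuad hm hf hd.le⟩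
  rw [← hd, coeff_natDegree, leadingCoeff_ne_zero]
  rintro rfl
  exact (pow_pos (by omega) 2).ne (natDegree_zero.symm.trans hd)

theorem eq_additiveQuad_of_natDegree (hm : 1 < m) {f : F[X]} (hf : f ∈ additivePolys F m)
    (hd : f.natDegree = m) : ∃ β γ, β ≠ 0 ∧ f = additiveQuad m 0 β γ := by
  have h1 : m < m ^ 2 := by nlinarith
  have h := eq_additiveQuad hm hf (by omega)
  rw [coeff_eq_zero_of_natDegree_lt (n := m ^ 2) (by omega)] at h
  refine ⟨_, _, ?_, h⟩
  conv_lhs => rw [← hd]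
  rw [coeff_natDegree, leadingCoeff_ne_zero]
  rintro rfl
  exact (Nat.zero_lt_of_lt hm).ne (natDegree_zero.symm.trans hd)

/-- Additivity of the m-th power is a hypothesis so that the formula serves both L[x; r] and the
centre K[x; q]. -/
theorem additiveQuad_comp (hadd : ∀ x y : F[X], (x + y) ^ m = x ^ m + y ^ m)
    (g₁ g₀ h₁ h₀ : F) :
    (additiveQuad m 0 g₁ g₀).comp (additiveQuad m 0 h₁ h₀) =
      additiveQuad m (g₁ * h₁ ^ m) (g₁ * h₀ ^ m + g₀ * h₁) (g₀ * h₀) := by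
  simp only [additiveQuad, C_0, zero_mul, zero_add, add_comp, mul_comp, C_comp, pow_comp, X_comp,
    hadd, mul_pow, ← pow_mul, ← sq, C_mul, C_add, C_pow]
  ring

/-- The exponents m^i are positive, so X divides g. -/
theorem dvd_comp_of_mem_additivePolys (hm : 0 < m) {g : F[X]} (hg : g ∈ additivePolys F m)
    (f : F[X]) : f ∣ g.comp f := by
  have h0 : X ∣ g := by
    rw [X_dvd_iff]
    by_contra h
    obtain ⟨i, hi⟩ := additivePolys_coeff hg 0 h
    exact (pow_pos hm i).ne hi
  obtain ⟨k, rfl⟩ := h0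
  rw [mul_comp, X_comp]
  exact dvd_mul_right _ _

theorem tau_additiveQuad (hm : 1 < m) {α : F} (hα : α ≠ 0) (β γ : F) :
    tau m (additiveQuad m α β γ) = C α * X ^ 2 + C β * X + C γ := by
  have h3 : 3 ≤ m ^ 2 + 1 := by nlinarith
  -- The sum defining `tau` runs up to i = m^2; its terms with i ≥ 3 vanish because m^i exceeds the
  -- degree.
  rw [tau, additiveQuad_natDegree hm hα, ← Finset.sum_subset (Finset.range_subset_range.mpr h3)]
  · simp only [Finset.sum_range_succ, Finset.sum_range_zero, pow_zero, pow_one,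
      additiveQuad_coeff_sq hm, additiveQuad_coeff_self hm, additiveQuad_coeff_one hm]
    ring
  · intro i _ hi
    rw [coeff_eq_zero_of_natDegree_lt, C_0, zero_mul]
    rw [additiveQuad_natDegree hm hα]
    rw [Finset.mem_range] at hi
    exact Nat.pow_lt_pow_right hm (by omega)

theorem tau_additiveQuad_zero (hm : 1 < m) {β : F} (hβ : β ≠ 0) (γ : F) :
    tau m (additiveQuad m 0 β γ) = C β * X + C γ := by
  have h3 : 2 ≤ m + 1 := by omega
  rw [tau, additiveQuad_natDegree_zero hm hβ,
    ← Finset.sum_subset (Finset.range_subset_range.mpr h3)]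
  · simp only [Finset.sum_range_succ, Finset.sum_range_zero, pow_zero, pow_one,
      additiveQuad_coeff_self hm, additiveQuad_coeff_one hm]
    ring
  · intro i _ hi
    rw [coeff_eq_zero_of_natDegree_lt, C_0, zero_mul]
    rw [additiveQuad_natDegree_zero hm hβ]
    rw [Finset.mem_range] at hi
    calc m = m ^ 1 := (pow_one m).symm
      _ < m ^ i := Nat.pow_lt_pow_right hm (by omega)

end AdditivePolynomials

/-! ### Left compositions as ordinary multiples -/

section CentralLeftCompositions

variable {K L : Type*} [Field K] [Finite K] [Field L] [Finite L] [Algebra K L]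

theorem add_pow_natCard_extension (L : Type*) [Field L] [Finite L] [Algebra K L]
    {A : Type*} [CommRing A] [Algebra K A] (x y : A) :
    (x + y) ^ Nat.card L = x ^ Nat.card L + y ^ Nat.card L := by
  rw [Module.natCard_eq_pow_finrank (K := K) (V := L)]
  induction Module.finrank K L with
  | zero => simp
  | succ k ih => rw [pow_succ, pow_mul, ih, add_pow_natCard K, ← pow_mul, ← pow_mul]

theorem pow_natCard_extension (L : Type*) [Field L] [Finite L] [Algebra K L] (c : K) :
    c ^ Nat.card L = c := by
  apply (algebraMap K L).injective
  rw [map_pow, pow_natCard_self]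

theorem additivePolys_map {F : K[X]} (hF : F ∈ additivePolys K (Nat.card L)) :
    F.map (algebraMap K L) ∈ additivePolys L (Nat.card K) := by
  induction hF using Submodule.span_induction with
  | mem x hx =>
    obtain ⟨i, rfl⟩ := hx
    refine Submodule.subset_span ⟨Module.finrank K L * i, ?_⟩
    simp only [Polynomial.map_pow, map_X, Module.natCard_eq_pow_finrank (K := K) (V := L),
      ← pow_mul]
  | zero => simp
  | add x y _ _ hx hy => rw [Polynomial.map_add]; exact add_mem hx hy
  | smul a x _ hx =>
    rw [Polynomial.map_smul]
    exact Submodule.smul_mem _ _ hx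

/-- Division with remainder in the composition ring leaves a remainder of smaller degree that f
still divides, hence zero. -/
theorem exists_comp_iff_dvd {f P : L[X]} (hf : f ∈ additivePolys L (Nat.card K)) (h0 : f ≠ 0)
    (hP : P ∈ additivePolys L (Nat.card K)) :
    (∃ g ∈ additivePolys L (Nat.card K), P = g.comp f) ↔ f ∣ P := by
  constructor
  · rintro ⟨g, hg, rfl⟩
    exact dvd_comp_of_mem_additivePolys Nat.card_pos hg f
  · intro hdvd
    have := Fintype.ofFinite K
    obtain ⟨p, hpK, e, hp, hcard⟩ := FiniteField.card' K
    have : Fact p.Prime := ⟨hp⟩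
    have : CharP L p := charP_of_injective_algebraMap (algebraMap K L).injective p
    have hr : Nat.card K = p ^ (e : ℕ) := by rw [Nat.card_eq_fintype_card, hcard]
    obtain ⟨g, hg, hlt⟩ : ∃ g ∈ additivePolys L (Nat.card K),
        (P - g.comp f).degree < f.degree := by
      rw [hr] at hf hP ⊢
      exact additivePolys_divide e.ne_zero hf h0 _ _ hP (Nat.lt_succ_self _)
    refine ⟨g, hg, sub_eq_zero.mp (eq_zero_of_dvd_of_degree_lt ?_ hlt)⟩
    exact dvd_sub hdvd (dvd_comp_of_mem_additivePolys Nat.card_pos hg f)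

theorem isCentralLeftComposition_iff {f : L[X]} (hf : f ∈ additivePolys L (Nat.card K))
    (h0 : f ≠ 0) {F : K[X]} :
    IsCentralLeftComposition f F ↔
      F ∈ additivePolys K (Nat.card L) ∧ F.Monic ∧ f ∣ F.map (algebraMap K L) := by
  constructor
  · intro h
    exact ⟨h.central, h.monic, (exists_comp_iff_dvd hf h0 (additivePolys_map h.central)).mp
      h.exists_comp⟩
  · rintro ⟨h1, h2, h3⟩
    exact ⟨h1, h2, (exists_comp_iff_dvd hf h0 (additivePolys_map h1)).mpr h3⟩

end CentralLeftCompositions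

/-! ### Decompositions as roots, and the possible numbers of roots -/

section Slopes

variable {K L : Type*} [Field K] [Finite K] [Field L] [Finite L] [Algebra K L]

/-- The roots `u` of `α u^{r+1} + β u + γ`; they parametrize the right components `x^r - u x` of
`α x^{r^2} + β x^r + γ x`. -/
noncomputable def slopes (r : ℕ) (α β γ : L) : Finset L :=
  (Set.toFinite {u : L | α * u ^ (r + 1) + β * u + γ = 0}).toFinset

theorem mem_slopes {r : ℕ} {α β γ u : L} :
    u ∈ slopes r α β γ ↔ α * u ^ (r + 1) + β * u + γ = 0 := by
  simp [slopes]

theorem slopes_div {r : ℕ} {α : L} (hα : α ≠ 0) (β γ : L) :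
    slopes r α β γ = slopes r 1 (β / α) (γ / α) := by
  ext u
  rw [mem_slopes, mem_slopes]
  have h : α * u ^ (r + 1) + β * u + γ =
      α * (1 * u ^ (r + 1) + β / α * u + γ / α) := by
    field_simp
  rw [h, mul_eq_zero, or_iff_right hα]

theorem neg_pow_natCard (x : L) : (-x) ^ Nat.card K = -x ^ Nat.card K := by
  have h := sub_pow_natCard K 0 x
  rwa [zero_pow Nat.card_pos.ne', zero_sub, zero_sub] at h

theorem isAdditiveDecomposition_iff {α : L} (hα : α ≠ 0) (β γ : L) {g h : L[X]} :
    IsAdditiveDecomposition (Nat.card K) (additiveQuad (Nat.card K) α β γ) g h ↔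
      ∃ u ∈ slopes (Nat.card K) α β γ, g = additiveQuad (Nat.card K) 0 α (β + α * u ^ Nat.card K) ∧
        h = additiveQuad (Nat.card K) 0 1 (-u) := by
  have hr : 1 < Nat.card K := Finite.one_lt_card
  have hadd : ∀ x y : L[X], (x + y) ^ Nat.card K = x ^ Nat.card K + y ^ Nat.card K :=
    add_pow_natCard K
  constructor
  · intro H
    obtain ⟨i, hi⟩ := additivePolys_natDegree H.left_mem (ne_zero_of_natDegree_gt H.left_degree)
    obtain ⟨j, hj⟩ := additivePolys_natDegree H.right_mem (ne_zero_of_natDegree_gt H.right_degree)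
    -- The degrees r^i and r^j multiply to r^2 and neither is 1, so i = j = 1.
    have hd := congrArg natDegree H.comp_eq
    rw [natDegree_comp, additiveQuad_natDegree hr hα, hi, hj, ← pow_add] at hd
    have hij := Nat.pow_right_injective hr hd
    have h1 := H.left_degree
    have h2 := H.right_degree
    have hi0 : i ≠ 0 := by rintro rfl; rw [hi] at h1; simp at h1
    have hj0 : j ≠ 0 := by rintro rfl; rw [hj] at h2; simp at h2
    obtain rfl : i = 1 := by omega
    obtain rfl : j = 1 := by omega
    rw [pow_one] at hi hj
    obtain ⟨g₁, g₀, -, rfl⟩ := eq_additiveQuad_of_natDegree hr H.left_mem hi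
    obtain ⟨h₁, h₀, -, rfl⟩ := eq_additiveQuad_of_natDegree hr H.right_mem hj
    have hm := H.right_monic
    rw [Monic, leadingCoeff, hj, additiveQuad_coeff_self hr] at hm
    subst hm
    have hc := H.comp_eq
    rw [additiveQuad_comp hadd, additiveQuad_inj hr, one_pow, mul_one, mul_one] at hc
    obtain ⟨rfl, rfl, rfl⟩ := hc
    refine ⟨-h₀, ?_, ?_, by rw [neg_neg]⟩
    · rw [mem_slopes, pow_succ, neg_pow_natCard (K := K)]
      ring
    · rw [neg_pow_natCard (K := K)]
      congr 1
      ring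
  · rintro ⟨u, hu, rfl, rfl⟩
    rw [mem_slopes] at hu
    refine ⟨additiveQuad_mem _ _ _, additiveQuad_mem _ _ _, additiveQuad_monic_zero hr _, ?_, ?_, ?_⟩
    · rw [additiveQuad_natDegree_zero hr hα]; exact hr
    · rw [additiveQuad_natDegree_zero hr one_ne_zero]; exact hr
    · rw [additiveQuad_comp hadd, additiveQuad_inj hr, neg_pow_natCard (K := K)]
      refine ⟨by simp, by ring, ?_⟩
      linear_combination -hu

/-- All left components have degree r, so the collisions are the subsets of the set `D` of all
decompositions, and a proper subset can be enlarged by one element. -/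
theorem hasMaximalCollision_iff {α : L} (hα : α ≠ 0) (β γ : L) (i : ℕ) :
    HasMaximalCollision (Nat.card K) (additiveQuad (Nat.card K) α β γ) i ↔
      i = (slopes (Nat.card K) α β γ).card := by
  classical
  have hr : 1 < Nat.card K := Finite.one_lt_card
  set f := additiveQuad (Nat.card K) α β γ
  set D : Finset (L[X] × L[X]) := (slopes (Nat.card K) α β γ).image fun u =>
    (additiveQuad (Nat.card K) 0 α (β + α * u ^ Nat.card K), additiveQuad (Nat.card K) 0 1 (-u))
    with hD
  have hDmem : ∀ p, p ∈ D ↔ IsAdditiveDecomposition (Nat.card K) f p.1 p.2 := by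
    rintro ⟨g, h⟩
    rw [isAdditiveDecomposition_iff hα, hD, Finset.mem_image]
    simp only [Prod.mk.injEq, eq_comm]
  have hDdeg : ∀ p ∈ D, p.1.natDegree = Nat.card K := by
    intro p hp
    obtain ⟨u, -, rfl⟩ := Finset.mem_image.mp hp
    exact additiveQuad_natDegree_zero hr hα _
  have hDcard : D.card = (slopes (Nat.card K) α β γ).card := by
    apply Finset.card_image_of_injective
    intro u v huv
    have := (Prod.mk.inj huv).2
    rw [additiveQuad_inj hr] at this
    exact neg_injective this.2.2
  have hcol : ∀ S, IsCollision (Nat.card K) f S ↔ S ⊆ D := by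
    intro S
    constructor
    · intro hS p hp
      exact (hDmem p).mpr (hS.1 p hp)
    · intro hS
      exact ⟨fun p hp => (hDmem p).mp (hS hp),
        fun p hp p' hp' => (hDdeg p (hS hp)).trans (hDdeg p' (hS hp')).symm⟩
  rw [← hDcard]
  constructor
  · rintro ⟨S, hS, rfl, hmax⟩
    rw [hcol] at hS
    congr 1
    refine hS.antisymm fun p hp => ?_
    by_contra hpS
    exact hmax ⟨insert p S, (hcol _).mpr (Finset.insert_subset hp hS),
      Finset.card_insert_of_notMem hpS, Finset.subset_insert _ _⟩
  · rintro rfl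
    refine ⟨D, (hcol _).mpr subset_rfl, rfl, ?_⟩
    rintro ⟨S, hS, hc, -⟩
    have := Finset.card_le_card ((hcol _).mp hS)
    omega

/-- The solutions `s` of `v s^r - u s = 1`; they parametrize the right components of
`(x^r - v x) ∘ (x^r - u x)` other than `x^r - u x`. -/
noncomputable def shifts (r : ℕ) (u v : L) : Finset L :=
  (Set.toFinite {s : L | v * s ^ r - u * s = 1}).toFinset

theorem mem_shifts {r : ℕ} {u v s : L} : s ∈ shifts r u v ↔ v * s ^ r - u * s = 1 := by
  simp [shifts]

/-- For w ≠ u the slope equation becomes (w - u)^r w = v(w - u); with w = u + 1/s, multiplication by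
s^{r+1} gives us + 1 = v s^r, which is additive in s up to a constant. -/
theorem card_slopes (u v : L) :
    (slopes (Nat.card K) 1 (-u ^ Nat.card K - v) (u * v)).card =
      (shifts (Nat.card K) u v).card + 1 := by
  classical
  have hr : 0 < Nat.card K := Nat.card_pos
  have h0 : ∀ s ∈ shifts (Nat.card K) u v, s ≠ 0 := by
    rintro _ hs rfl
    rw [mem_shifts, zero_pow hr.ne'] at hs
    simp at hs
  have himg : slopes (Nat.card K) 1 (-u ^ Nat.card K - v) (u * v) =
      insert u ((shifts (Nat.card K) u v).image fun s => u + s⁻¹) := by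
    ext w
    rw [Finset.mem_insert, Finset.mem_image, mem_slopes, pow_succ]
    constructor
    · intro hw
      rw [or_iff_not_imp_left]
      intro hne
      have ht : w - u ≠ 0 := sub_ne_zero.mpr hne
      refine ⟨(w - u)⁻¹, ?_, by rw [inv_inv]; ring⟩
      have hpow := sub_pow_natCard K w u
      have hT : (w - u) ^ Nat.card K ≠ 0 := pow_ne_zero _ ht
      rw [mem_shifts, inv_pow]
      field_simp
      linear_combination -hw - w * hpow
    · rintro (rfl | ⟨s, hs, rfl⟩)
      · ring
      · have hs0 := h0 s hs
        rw [mem_shifts] at hs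
        have hT : s ^ Nat.card K ≠ 0 := pow_ne_zero _ hs0
        rw [add_pow_natCard K, inv_pow]
        field_simp
        linear_combination -hs
  rw [himg, Finset.card_insert_of_notMem, Finset.card_image_of_injective]
  · intro s t hst
    simpa using hst
  · rw [Finset.mem_image]
    rintro ⟨s, hs, h⟩
    simp [h0 s hs] at h

/-- The map `s ↦ v s^r - u s`. -/
noncomputable def shiftMap (K : Type*) [Field K] [Finite K] {L : Type*} [Field L] [Algebra K L]
    (u v : L) : L →ₗ[K] L where
  toFun s := v * s ^ Nat.card K - u * s
  map_add' s t := by rw [add_pow_natCard K]; ring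
  map_smul' c s := by
    rw [RingHom.id_apply, Algebra.smul_def, Algebra.smul_def, mul_pow, algebraMap_pow_natCard]
    ring

theorem shiftMap_apply (u v s : L) : shiftMap K u v s = v * s ^ Nat.card K - u * s := rfl

/-- A nonzero kernel element s of `shiftMap` gives u = s^{r-1} v and so N(u) = N(v). With distinct
norms the map is therefore bijective. -/
theorem card_shifts_of_norm_ne {u v : L} (h : embeddedNorm K u ≠ embeddedNorm K v) :
    (shifts (Nat.card K) u v).card = 1 := by
  have hinj : Function.Injective (shiftMap K u v) := by
    rw [← LinearMap.ker_eq_bot, LinearMap.ker_eq_bot']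
    intro s hs
    by_contra hs0
    apply h
    rw [← embeddedNorm_pow_mul hs0 v]
    congr 1
    apply mul_right_cancel₀ hs0
    have : s ^ Nat.card K = s ^ (Nat.card K - 1) * s := by
      rw [← pow_succ, Nat.sub_add_cancel Nat.card_pos]
    rw [shiftMap_apply] at hs
    linear_combination -hs + v * this
  obtain ⟨s, hs⟩ := Finite.injective_iff_surjective.mp hinj 1
  rw [Finset.card_eq_one]
  refine ⟨s, Finset.eq_singleton_iff_unique_mem.mpr ⟨mem_shifts.mpr hs, fun t ht => ?_⟩⟩
  exact hinj ((mem_shifts.mp ht).trans hs.symm)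

/-- A nonempty solution set is a coset of the kernel, a K-space with at most r elements. -/
theorem card_shifts (K : Type*) {L : Type*} [Field K] [Finite K] [Field L] [Finite L] [Algebra K L]
    (u v : L) : (shifts (Nat.card K) u v).card = 0 ∨ (shifts (Nat.card K) u v).card = 1 ∨
      (shifts (Nat.card K) u v).card = Nat.card K := by
  classical
  have hr : 1 < Nat.card K := Finite.one_lt_card
  rcases (shifts (Nat.card K) u v).eq_empty_or_nonempty with he | ⟨s, hs⟩
  · left; rw [he, Finset.card_empty]
  right
  rw [mem_shifts] at hs
  have hker : (shifts (Nat.card K) u v).card = Nat.card (LinearMap.ker (shiftMap K u v)) := by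
    rw [← Nat.card_eq_finsetCard]
    refine Nat.card_congr ⟨fun t => ⟨t - s, ?_⟩, fun t => ⟨t + s, ?_⟩, ?_, ?_⟩
    · rw [LinearMap.mem_ker, map_sub, shiftMap_apply, shiftMap_apply, hs, mem_shifts.mp t.2,
        sub_self]
    · have := t.2
      rw [LinearMap.mem_ker, shiftMap_apply] at this
      rw [mem_shifts, add_pow_natCard K]
      linear_combination this + hs
    · intro t; simp
    · intro t; simp
  have hle : (shifts (Nat.card K) u v).card ≤ Nat.card K := by
    -- The constant term -1 keeps this polynomial nonzero even for u = v = 0.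
    have hp : C v * X ^ Nat.card K - C u * X - 1 ≠ (0 : L[X]) := by
      intro h
      have := congrArg (eval 0) h
      simp [(zero_lt_one.trans hr).ne'] at this
    have hd : (C v * X ^ Nat.card K - C u * X - 1 : L[X]).natDegree ≤ Nat.card K := by
      refine (natDegree_sub_le_of_le (natDegree_sub_le_of_le (m := Nat.card K) (n := Nat.card K)
        ?_ ?_) (n := Nat.card K) ?_).trans (by simp)
      · exact natDegree_C_mul_X_pow_le _ _
      · exact (natDegree_C_mul_le _ _).trans (natDegree_X_le.trans hr.le)
      · simp
    refine (Finset.card_le_card (t := (C v * X ^ Nat.card K - C u * X - 1 : L[X]).roots.toFinset)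
      ?_).trans ((Multiset.toFinset_card_le _).trans ((card_roots' _).trans hd))
    intro t ht
    rw [Multiset.mem_toFinset, mem_roots hp]
    simp [mem_shifts.mp ht]
  rw [hker, Module.natCard_eq_pow_finrank (K := K)] at hle ⊢
  have : Module.finrank K (LinearMap.ker (shiftMap K u v)) ≤ 1 := by
    rw [← Nat.pow_le_pow_iff_right hr, pow_one]
    exact hle
  interval_cases Module.finrank K (LinearMap.ker (shiftMap K u v)) <;> simp

theorem exists_left_factor {a b u : L} (hu : u ∈ slopes (Nat.card K) 1 a b) :
    ∃ v, a = -u ^ Nat.card K - v ∧ b = u * v := by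
  rw [mem_slopes, pow_succ] at hu
  refine ⟨-u ^ Nat.card K - a, by ring, by linear_combination hu⟩

theorem mem_slopes_self (u v : L) :
    u ∈ slopes (Nat.card K) 1 (-u ^ Nat.card K - v) (u * v) := by
  rw [mem_slopes]; ring

theorem card_slopes_cases (K : Type*) {L : Type*} [Field K] [Finite K] [Field L] [Finite L]
    [Algebra K L] (a b : L) :
    (slopes (Nat.card K) 1 a b).card = 0 ∨ (slopes (Nat.card K) 1 a b).card = 1 ∨
      (slopes (Nat.card K) 1 a b).card = 2 ∨
      (slopes (Nat.card K) 1 a b).card = Nat.card K + 1 := by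
  rcases (slopes (Nat.card K) 1 a b).eq_empty_or_nonempty with he | ⟨u, hu⟩
  · left; rw [he, Finset.card_empty]
  right
  obtain ⟨v, rfl, rfl⟩ := exists_left_factor hu
  rw [card_slopes]
  have := card_shifts K u v
  omega

end Slopes

/-! ### Double counting and the values of c_i -/

section Counting

variable {K L : Type*} [Field K] [Finite K] [Field L] [Fintype L] [Algebra K L]

/-- Count triples (u, v, s): s = 0 never occurs, and for s ≠ 0 each v determines u. -/
theorem sum_card_shifts (K L : Type*) [Field K] [Finite K] [Field L] [Fintype L] [Algebra K L] :
    ∑ p : L × L, (shifts (Nat.card K) p.1 p.2).card = (Fintype.card L - 1) * Fintype.card L := by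
  classical
  have hsw := Finset.sum_card_bipartiteAbove_eq_sum_card_bipartiteBelow
    (s := (Finset.univ : Finset (L × L))) (t := (Finset.univ : Finset L))
    (fun p s => s ∈ shifts (Nat.card K) p.1 p.2)
  have h1 : ∀ p : L × L, (Finset.univ : Finset L).bipartiteAbove
      (fun p s => s ∈ shifts (Nat.card K) p.1 p.2) p = shifts (Nat.card K) p.1 p.2 := by
    intro p; ext s; simp [Finset.bipartiteAbove]
  simp only [h1] at hsw
  rw [hsw, ← Finset.sum_erase_add _ _ (Finset.mem_univ (0 : L)), Finset.sum_const_nat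
    (m := Fintype.card L), Finset.card_erase_of_mem (Finset.mem_univ _), Finset.card_univ]
  · rw [Nat.add_eq_left, Finset.card_eq_zero, Finset.eq_empty_iff_forall_notMem]
    intro p hp
    simp [Finset.bipartiteBelow, mem_shifts, (Nat.card_pos (α := K)).ne'] at hp
  · intro s hs
    have hs0 : s ≠ 0 := Finset.ne_of_mem_erase hs
    rw [← Finset.card_univ]
    symm
    apply Finset.card_bij (fun v _ => ((v * s ^ Nat.card K - 1) / s, v))
    · intro v _
      simp only [Finset.bipartiteBelow, Finset.mem_filter, Finset.mem_univ, true_and, mem_shifts]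
      field_simp
      ring
    · intro v _ v' _ h
      exact (Prod.mk.inj h).2
    · rintro ⟨u, v⟩ h
      simp only [Finset.bipartiteBelow, Finset.mem_filter, Finset.mem_univ, true_and,
        mem_shifts] at h
      refine ⟨v, Finset.mem_univ _, ?_⟩
      rw [Prod.mk.injEq]
      refine ⟨?_, rfl⟩
      field_simp
      linear_combination h

/-- Each pair `(s, t)` that is linearly independent over `K` belongs to exactly one `(u, v)`. -/
theorem card_filter_mem_shifts (s t : L) [DecidableEq L] :
    (Finset.univ.filter fun p : L × L => s ∈ shifts (Nat.card K) p.1 p.2 ∧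
      t ∈ shifts (Nat.card K) p.1 p.2 ∧ s ≠ t).card =
      if s ^ Nat.card K * t ≠ t ^ Nat.card K * s then 1 else 0 := by
  split_ifs with h
  -- `D` is the determinant of the two equations, linear in (u, v); the witness below is Cramer's
  -- rule.
  · set D := s ^ Nat.card K * t - t ^ Nat.card K * s with hD
    have hD0 : D ≠ 0 := sub_ne_zero.mpr h
    rw [Finset.card_eq_one]
    refine ⟨((s - t) ^ Nat.card K * (-D⁻¹), (t - s) * D⁻¹), ?_⟩
    ext ⟨u, v⟩
    simp only [Finset.mem_filter, Finset.mem_univ, true_and, mem_shifts, Finset.mem_singleton,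
      Prod.mk.injEq]
    rw [sub_pow_natCard K]
    constructor
    · rintro ⟨h1, h2, -⟩
      constructor
      · apply mul_right_cancel₀ hD0
        rw [mul_assoc, neg_mul, inv_mul_cancel₀ hD0]
        linear_combination t ^ Nat.card K * h1 - s ^ Nat.card K * h2 + u * hD
      · apply mul_right_cancel₀ hD0
        rw [mul_assoc, inv_mul_cancel₀ hD0]
        linear_combination t * h1 - s * h2 + v * hD
    · rintro ⟨rfl, rfl⟩
      have hi := mul_inv_cancel₀ hD0
      refine ⟨?_, ?_, ?_⟩
      · linear_combination hi - D⁻¹ * hD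
      · linear_combination hi - D⁻¹ * hD
      · rintro rfl
        exact h rfl
  · rw [Finset.card_eq_zero, Finset.eq_empty_iff_forall_notMem]
    rintro ⟨u, v⟩ hp
    simp only [Finset.mem_filter, Finset.mem_univ, true_and, mem_shifts] at hp
    obtain ⟨h1, h2, hne⟩ := hp
    push Not at h
    apply hne
    linear_combination t * h1 - s * h2 - v * h

/-- For t ≠ 0 the excluded s are those with (s/t)^r = s/t, that is, the r elements of Kt; t = 0
contributes nothing. -/
theorem card_independent_pairs (K L : Type*) [Field K] [Finite K] [Field L] [Fintype L]
    [Algebra K L] [DecidableEq L] :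
    ∑ p : L × L, (if p.1 ^ Nat.card K * p.2 ≠ p.2 ^ Nat.card K * p.1 then 1 else 0) =
      (Fintype.card L - 1) * (Fintype.card L - Nat.card K) := by
  have := Fintype.ofFinite K
  rw [Fintype.sum_prod_type_right, ← Finset.sum_erase_add _ _ (Finset.mem_univ (0 : L)),
    Finset.sum_const_nat (m := Fintype.card L - Nat.card K),
    Finset.card_erase_of_mem (Finset.mem_univ _), Finset.card_univ]
  · simp
  · intro t ht
    have ht0 : t ≠ 0 := Finset.ne_of_mem_erase ht
    rw [Finset.sum_boole, Nat.cast_id, Finset.filter_not, Finset.card_sdiff_of_subset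
      (Finset.filter_subset _ _), Finset.card_univ]
    congr 1
    have hK : (Finset.univ : Finset K).card = Nat.card K := by
      rw [Finset.card_univ, Nat.card_eq_fintype_card]
    conv_rhs => rw [← hK]
    symm
    apply Finset.card_bij (fun c _ => algebraMap K L c * t)
    · intro c _
      rw [Finset.mem_filter, mul_pow, algebraMap_pow_natCard]
      exact ⟨Finset.mem_univ _, by ring⟩
    · intro c _ c' _ h
      exact (algebraMap K L).injective (mul_right_cancel₀ ht0 h)
    · intro s hs
      have hs := (Finset.mem_filter.mp hs).2
      obtain ⟨c, hc⟩ : ∃ c : K, algebraMap K L c = s / t := by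
        apply exists_algebraMap_of_pow_natCard
        have ht1 : t ^ Nat.card K ≠ 0 := pow_ne_zero _ ht0
        rw [div_pow]
        field_simp
        linear_combination hs
      exact ⟨c, Finset.mem_univ _, by rw [hc, div_mul_cancel₀ _ ht0]⟩

theorem sum_card_offDiag_shifts (K L : Type*) [Field K] [Finite K] [Field L] [Fintype L]
    [Algebra K L] [DecidableEq L] :
    ∑ p : L × L, (shifts (Nat.card K) p.1 p.2).offDiag.card =
      (Fintype.card L - 1) * (Fintype.card L - Nat.card K) := by
  have hsw := Finset.sum_card_bipartiteAbove_eq_sum_card_bipartiteBelow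
    (s := (Finset.univ : Finset (L × L))) (t := (Finset.univ : Finset (L × L)))
    (fun p s => s ∈ (shifts (Nat.card K) p.1 p.2).offDiag)
  have h1 : ∀ p : L × L, (Finset.univ : Finset (L × L)).bipartiteAbove
      (fun p s => s ∈ (shifts (Nat.card K) p.1 p.2).offDiag) p =
        (shifts (Nat.card K) p.1 p.2).offDiag := by
    intro p; ext s; simp [Finset.bipartiteAbove]
  simp only [h1] at hsw
  rw [hsw, ← card_independent_pairs]
  refine Finset.sum_congr rfl fun s _ => ?_
  rw [← card_filter_mem_shifts]
  simp only [Finset.bipartiteBelow, Finset.mem_offDiag]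

/-- The number of pairs `(u, v)` for which `v s^r - u s = 1` has exactly `i` solutions. -/
noncomputable def shiftCount (K : Type*) (L : Type*) [Field K] [Field L] [Fintype L] (i : ℕ) : ℕ :=
  (Finset.univ.filter fun p : L × L => (shifts (Nat.card K) p.1 p.2).card = i).card

theorem sum_shiftCount (K L : Type*) [Field K] [Finite K] [Field L] [Fintype L] [Algebra K L]
    (φ : ℕ → ℕ) :
    ∑ p : L × L, φ (shifts (Nat.card K) p.1 p.2).card =
      shiftCount K L 0 * φ 0 + shiftCount K L 1 * φ 1 +
        shiftCount K L (Nat.card K) * φ (Nat.card K) := by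
  classical
  have hr : 1 < Nat.card K := Finite.one_lt_card
  rw [← Finset.sum_fiberwise_of_maps_to (t := ({0, 1, Nat.card K} : Finset ℕ))
    (g := fun p : L × L => (shifts (Nat.card K) p.1 p.2).card)]
  · rw [Finset.sum_insert, Finset.sum_insert, Finset.sum_singleton, ← add_assoc]
    · simp only [shiftCount]
      congr 1
      · congr 1
        all_goals
          refine Finset.sum_const_nat fun p hp => ?_
          rw [(Finset.mem_filter.mp hp).2]
      · refine Finset.sum_const_nat fun p hp => ?_
        rw [(Finset.mem_filter.mp hp).2]
    · rw [Finset.mem_singleton]; omega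
    · simp only [Finset.mem_insert, Finset.mem_singleton]; omega
  · intro p _
    simp only [Finset.mem_insert, Finset.mem_singleton]
    exact card_shifts K p.1 p.2

/-- The number of pairs `(a, b)` for which `u^{r+1} + a u + b` has exactly `i` roots. -/
noncomputable def slopeCount (K : Type*) (L : Type*) [Field K] [Field L] [Fintype L] (i : ℕ) : ℕ :=
  (Finset.univ.filter fun p : L × L => (slopes (Nat.card K) 1 p.1 p.2).card = i).card

/-- The map (u, v) ↦ (-u^r - v, uv) has the slopes of (a, b) as its fibre, and by `card_slopes` a
pair with i shifts lies over an (a, b) with i+1 slopes. -/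
theorem shiftCount_eq (K L : Type*) [Field K] [Finite K] [Field L] [Fintype L] [Algebra K L]
    (i : ℕ) : shiftCount K L i = slopeCount K L (i + 1) * (i + 1) := by
  classical
  rw [shiftCount, slopeCount, Finset.card_eq_sum_card_fiberwise
    (f := fun p : L × L => (-p.1 ^ Nat.card K - p.2, p.1 * p.2))
    (t := Finset.univ.filter fun p : L × L => (slopes (Nat.card K) 1 p.1 p.2).card = i + 1)]
  · refine Finset.sum_const_nat ?_
    rintro ⟨a, b⟩ hab
    have hab := (Finset.mem_filter.mp hab).2
    rw [← hab]
    symm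
    apply Finset.card_bij (fun u _ => (u, -u ^ Nat.card K - a))
    · intro u hu
      obtain ⟨v, rfl, rfl⟩ := exists_left_factor hu
      rw [card_slopes] at hab
      simp only [Finset.mem_filter, Finset.mem_univ, true_and, sub_sub_cancel, and_true]
      omega
    · intro u _ u' _ h
      exact (Prod.mk.inj h).1
    · rintro ⟨u, v⟩ h
      simp only [Finset.mem_filter, Finset.mem_univ, true_and, Prod.mk.injEq] at h
      obtain ⟨-, rfl, rfl⟩ := h
      exact ⟨u, mem_slopes_self u v, by rw [sub_sub_cancel]⟩
  · intro p hp
    have hp := (Finset.mem_filter.mp hp).2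
    simp only [Finset.coe_filter, Finset.mem_univ, true_and, Set.mem_ofPred_eq]
    rw [card_slopes, hp]

theorem sum_slopeCount (K L : Type*) [Field K] [Finite K] [Field L] [Fintype L] [Algebra K L] :
    slopeCount K L 0 + slopeCount K L 1 + slopeCount K L 2 + slopeCount K L (Nat.card K + 1) =
      Fintype.card L ^ 2 := by
  classical
  have hr : 1 < Nat.card K := Finite.one_lt_card
  rw [sq, ← Fintype.card_prod, ← Finset.card_univ, Finset.card_eq_sum_card_fiberwise
    (f := fun p : L × L => (slopes (Nat.card K) 1 p.1 p.2).card)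
    (t := ({0, 1, 2, Nat.card K + 1} : Finset ℕ)), Finset.sum_insert, Finset.sum_insert,
    Finset.sum_insert, Finset.sum_singleton, ← add_assoc, ← add_assoc]
  · rfl
  · rw [Finset.mem_singleton]; omega
  · simp only [Finset.mem_insert, Finset.mem_singleton]; omega
  · simp only [Finset.mem_insert, Finset.mem_singleton]; omega
  · intro p _
    simp only [Finset.coe_insert, Finset.coe_singleton, Set.mem_insert_iff, Set.mem_singleton_iff]
    exact card_slopes_cases K p.1 p.2

theorem slopeCount_formulas (K L : Type*) [Field K] [Finite K] [Field L] [Fintype L] [Algebra K L]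
    {r q : ℚ} (hr : r = Nat.card K) (hq : q = Fintype.card L) :
    (slopeCount K L 0 : ℚ) = r * (q ^ 2 - 1) / (2 * (r + 1)) ∧
    (slopeCount K L 1 : ℚ) = (q ^ 2 - q) / r + 1 ∧
    (slopeCount K L 2 : ℚ) = (q - 1) ^ 2 * (r - 2) / (2 * (r - 1)) + q - 1 ∧
    (slopeCount K L (Nat.card K + 1) : ℚ) = (q - 1) * (q - r) / (r * (r ^ 2 - 1)) := by
  classical
  have hr1 : 1 < Nat.card K := Finite.one_lt_card
  have hq1 : 1 ≤ Fintype.card L := Fintype.card_pos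
  have hrq : Nat.card K ≤ Fintype.card L := by
    rw [← Nat.card_eq_fintype_card]
    exact Nat.card_le_card_of_injective _ (algebraMap K L).injective
  have e0 := sum_shiftCount K L (fun _ => 1)
  have e1 := sum_shiftCount K L (fun n => n)
  -- This weight vanishes at 0 and 1, so the equation isolates c_{r+1}; `e1`, `e0` and `e3` then
  -- yield c_2, c_1 and c_0.
  have e2 := sum_shiftCount K L (fun n => n * n - n)
  have e3 := sum_slopeCount K L
  simp only [← Finset.offDiag_card, sum_card_offDiag_shifts] at e2
  rw [sum_card_shifts] at e1
  simp only [Finset.sum_const, Finset.card_univ, Fintype.card_prod, smul_eq_mul] at e0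
  simp only [shiftCount_eq] at e0 e1 e2
  have hrr : Nat.card K ≤ Nat.card K * Nat.card K := Nat.le_mul_self _
  have e0' := congrArg (Nat.cast (R := ℚ)) e0
  have e1' := congrArg (Nat.cast (R := ℚ)) e1
  have e2' := congrArg (Nat.cast (R := ℚ)) e2
  have e3' := congrArg (Nat.cast (R := ℚ)) e3
  push_cast [Nat.cast_sub hq1, Nat.cast_sub hrq, Nat.cast_sub hrr, ← hr, ← hq] at e0' e1' e2' e3'
  have hr1' : (1 : ℚ) < r := by rw [hr]; exact_mod_cast hr1
  have n0 : r ≠ 0 := by linarith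
  have n1 : r - 1 ≠ 0 := by linarith
  have n2 : r + 1 ≠ 0 := by linarith
  have n3 : r ^ 2 - 1 ≠ 0 := by nlinarith
  generalize (Nat.cast (slopeCount K L 0) : ℚ) = c0 at *
  generalize (Nat.cast (slopeCount K L 1) : ℚ) = c1 at *
  generalize (Nat.cast (slopeCount K L 2) : ℚ) = c2 at *
  generalize (Nat.cast (slopeCount K L (Nat.card K + 1)) : ℚ) = c3 at *
  have h3 : c3 = (q - 1) * (q - r) / (r * (r ^ 2 - 1)) := by
    rw [eq_div_iff (mul_ne_zero n0 n3)]
    linear_combination -e2'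
  have h2 : c2 = (q - 1) ^ 2 * (r - 2) / (2 * (r - 1)) + q - 1 := by
    have : c2 * (2 * (r - 1)) = (q - 1) ^ 2 * (r - 2) + (q - 1) * (2 * (r - 1)) := by
      linear_combination e2' - (r - 1) * e1'
    field_simp
    linear_combination this
  have h1 : c1 = (q ^ 2 - q) / r + 1 := by
    have : c1 * r = q ^ 2 - q + r := by
      linear_combination -r * (e0' - e1') - e2'
    field_simp
    linear_combination this
  refine ⟨?_, h1, h2, h3⟩
  obtain rfl : c0 = q ^ 2 - c1 - c2 - c3 := by linear_combination e3'
  have n4 : r ^ 2 - 1 = (r - 1) * (r + 1) := by ring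
  rw [h1, h2, h3, n4]
  field_simp
  ring

end Counting

/-! ### Central multiples of a trinomial -/

section Multiples

variable {K L : Type*} [Field K] [Finite K] [Field L] [Finite L] [Algebra K L]

theorem aeval_additiveQuad {F A : Type*} [Field F] [CommRing A] [Algebra F A] (m : ℕ) (α β γ : F)
    (x : A) : aeval x (additiveQuad m α β γ) =
      algebraMap F A α * x ^ (m ^ 2) + algebraMap F A β * x ^ m + algebraMap F A γ * x := by
  simp [additiveQuad]

theorem additiveQuad_map {F E : Type*} [Field F] [Field E] (φ : F →+* E) (m : ℕ) (α β γ : F) :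
    (additiveQuad m α β γ).map φ = additiveQuad m (φ α) (φ β) (φ γ) := by
  simp [additiveQuad]

/-- Computing with the generic root in F[x]/(f) proves divisibility without separability, so b = 0
needs no separate treatment there. -/
theorem dvd_iff_aeval_root {F : Type*} [Field F] (f P : F[X]) :
    f ∣ P ↔ aeval (AdjoinRoot.root f) P = 0 := by
  rw [AdjoinRoot.aeval_eq, AdjoinRoot.mk_eq_zero]

theorem trinomial_dvd_norm_product (u v : L) :
    additiveQuad (Nat.card K) 1 (-u ^ Nat.card K - v) (u * v) ∣
      (additiveQuad (Nat.card L) 1 (-(Algebra.norm K u + Algebra.norm K v))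
        (Algebra.norm K u * Algebra.norm K v)).map (algebraMap K L) := by
  set f := additiveQuad (Nat.card K) 1 (-u ^ Nat.card K - v) (u * v) with hf
  have h0 : aeval (AdjoinRoot.root f) f = 0 := by rw [← dvd_iff_aeval_root]
  rw [hf, aeval_additiveQuad, ← hf, map_one, one_mul] at h0
  have h1 := trinomial_eq_zero_norm h0
  rw [dvd_iff_aeval_root, additiveQuad_map, aeval_additiveQuad]
  simp only [embeddedNorm, map_add, map_mul, map_neg, map_one] at h1 ⊢
  linear_combination h1

theorem trinomial_dvd_linear {u v u' v' : L} {c : K}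
    (ha : -u ^ Nat.card K - v = -u' ^ Nat.card K - v') (hb : u * v = u' * v') (hne : u ≠ u')
    (hv : Algebra.norm K v = c) (hv' : Algebra.norm K v' = c) :
    additiveQuad (Nat.card K) 1 (-u ^ Nat.card K - v) (u * v) ∣
      (additiveQuad (Nat.card L) 0 1 (-c)).map (algebraMap K L) := by
  set f := additiveQuad (Nat.card K) 1 (-u ^ Nat.card K - v) (u * v) with hf
  have h0 : aeval (AdjoinRoot.root f) f = 0 := by rw [← dvd_iff_aeval_root]
  rw [hf, aeval_additiveQuad, ← hf, map_one, one_mul] at h0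
  have h1 := trinomial_eq_zero_linear (c := algebraMap K L c) h0 ha hb hne
    (congrArg (algebraMap K L) hv) (congrArg (algebraMap K L) hv')
  rw [dvd_iff_aeval_root, additiveQuad_map, aeval_additiveQuad]
  simp only [map_zero, map_one, map_neg]
  linear_combination h1

/-- Modulo x^r - ux one has x^q = N(u)x as well as x^q = -γx, so x^r - ux divides (N(u) + γ)x, whose
degree is below r unless it vanishes. -/
theorem norm_eq_of_trinomial_dvd {a b u : L} (hu : u ∈ slopes (Nat.card K) 1 a b) {γ : K}
    (h : additiveQuad (Nat.card K) 1 a b ∣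
      (additiveQuad (Nat.card L) 0 1 γ).map (algebraMap K L)) :
    Algebra.norm K u = -γ := by
  have hr : 1 < Nat.card K := Finite.one_lt_card
  set g := additiveQuad (Nat.card K) 0 1 (-u) with hg
  have hgd := ((isAdditiveDecomposition_iff one_ne_zero a b).mpr ⟨u, hu, rfl, rfl⟩)
  have hgf : g ∣ additiveQuad (Nat.card K) 1 a b := by
    rw [← hgd.comp_eq]
    exact dvd_comp_of_mem_additivePolys Nat.card_pos hgd.left_mem _
  have h1 := (dvd_iff_aeval_root _ _).mp (hgf.trans h)
  have h0 : aeval (AdjoinRoot.root g) g = 0 := by rw [← dvd_iff_aeval_root]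
  rw [additiveQuad_map, aeval_additiveQuad] at h1
  rw [hg, aeval_additiveQuad, ← hg] at h0
  simp only [map_zero, map_one, map_neg] at h0 h1
  have h2 := pow_natCard_eq_norm_mul (K := K) (u := u) (x := AdjoinRoot.root g)
    (by linear_combination h0)
  by_contra hne
  have hne' : embeddedNorm K u + algebraMap K L γ ≠ 0 := by
    rw [embeddedNorm, ← map_add]
    exact (_root_.map_ne_zero _).mpr fun h => hne (eq_neg_of_add_eq_zero_left h)
  have hX : g ∣ C (embeddedNorm K u + algebraMap K L γ) * X := by
    rw [dvd_iff_aeval_root]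
    simp only [map_mul, aeval_C, aeval_X, map_add]
    linear_combination h1 - h2
  have hd := natDegree_le_of_dvd hX (mul_ne_zero (C_ne_zero.mpr hne') X_ne_zero)
  rw [natDegree_C_mul hne', natDegree_X, hg, additiveQuad_natDegree_zero hr one_ne_zero] at hd
  omega

/-- A nonzero root of a trinomial that is an eigenvector of the `q`-th power map yields a right
component. -/
theorem exists_slope_of_eigenvector {M : Type*} [Field M] [Algebra L M] {a b : L} {c : K} {x : M}
    (hx : x ≠ 0) (hf : aeval x (additiveQuad (Nat.card K) 1 a b) = 0)
    (hc : x ^ Nat.card L = algebraMap L M (algebraMap K L c) * x) :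
    ∃ u ∈ slopes (Nat.card K) 1 a b, algebraMap L M u = x ^ (Nat.card K - 1) := by
  have := Fintype.ofFinite K
  have hr : 1 ≤ Nat.card K := Nat.card_pos
  have hc0 : c ≠ 0 := by
    rintro rfl
    rw [map_zero, map_zero, zero_mul] at hc
    exact pow_ne_zero _ hx hc
  have hc1 : c ^ (Nat.card K - 1) = 1 := by
    rw [Nat.card_eq_fintype_card]; exact FiniteField.pow_card_sub_one_eq_one c hc0
  -- Since c^{r-1} = 1, the q-th power map fixes x^{r-1}.
  obtain ⟨u, hu⟩ : ∃ u : L, algebraMap L M u = x ^ (Nat.card K - 1) := by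
    apply exists_algebraMap_of_pow_natCard
    rw [← pow_mul, mul_comm, pow_mul, hc, mul_pow, ← map_pow, ← map_pow, hc1, map_one, map_one,
      one_mul]
  refine ⟨u, ?_, hu⟩
  rw [mem_slopes]
  apply (algebraMap L M).injective
  apply mul_right_cancel₀ hx
  rw [aeval_additiveQuad] at hf
  have e1 : x ^ Nat.card K = x ^ (Nat.card K - 1) * x := by
    rw [← pow_succ, Nat.sub_add_cancel hr]
  have e2 : x ^ (Nat.card K ^ 2) = (x ^ (Nat.card K - 1)) ^ (Nat.card K + 1) * x := by
    rw [← pow_mul, ← pow_succ]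
    congr 1
    obtain ⟨k, hk⟩ := Nat.exists_eq_add_of_le' hr
    rw [hk, Nat.add_sub_cancel]
    ring
  rw [e1, e2] at hf
  simp only [map_add, map_mul, map_pow, hu, map_one, map_zero] at hf ⊢
  linear_combination hf

theorem trinomial_separable {a b : L} (hb : b ≠ 0) :
    (additiveQuad (Nat.card K) 1 a b).Separable := by
  have h0 : (Nat.card K : L) = 0 := by
    have := Fintype.ofFinite K
    have h : (Nat.card K : K) = 0 := by
      rw [Nat.card_eq_fintype_card]; exact FiniteField.cast_card_eq_zero K
    have := congrArg (algebraMap K L) h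
    rwa [map_natCast, map_zero] at this
  have hder : derivative (additiveQuad (Nat.card K) 1 a b) = C b := by
    simp [additiveQuad, derivative_X_pow, h0]
  rw [separable_def, hder]
  exact isCoprime_one_right.of_isCoprime_of_dvd_right (isUnit_C.mpr hb.isUnit).dvd

theorem card_rootSet_trinomial {a b : L} (hb : b ≠ 0) :
    ((additiveQuad (Nat.card K) 1 a b).rootSet (AlgebraicClosure L)).ncard = Nat.card K ^ 2 := by
  rw [← Nat.card_coe_set_eq, Nat.card_eq_fintype_card,
    card_rootSet_eq_natDegree (trinomial_separable hb) (IsAlgClosed.splits _),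
    additiveQuad_natDegree Finite.one_lt_card one_ne_zero]

theorem mem_rootSet_trinomial {a b : L} {x : AlgebraicClosure L} :
    x ∈ (additiveQuad (Nat.card K) 1 a b).rootSet (AlgebraicClosure L) ↔
      aeval x (additiveQuad (Nat.card K) 1 a b) = 0 :=
  mem_rootSet_of_ne (additiveQuad_monic Finite.one_lt_card _ _).ne_zero

/-- Every nonzero root x of f is an eigenvector of the q-th power map, so x^{r-1} is a slope. The
map x ↦ x^{r-1} has fibres of size at most r-1, and r^2 - 1 = (r-1)(r+1). -/
theorem le_card_slopes_of_dvd {a b : L} (hb : b ≠ 0) {γ : K}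
    (h : additiveQuad (Nat.card K) 1 a b ∣
      (additiveQuad (Nat.card L) 0 1 γ).map (algebraMap K L)) :
    Nat.card K + 1 ≤ (slopes (Nat.card K) 1 a b).card := by
  classical
  have hr : 1 < Nat.card K := Finite.one_lt_card
  set f := additiveQuad (Nat.card K) 1 a b with hf
  set M := AlgebraicClosure L
  set R : Finset M := (f.rootSet_finite M).toFinset with hR
  have hRcard : R.card = Nat.card K ^ 2 := by
    rw [← Set.ncard_eq_toFinset_card (f.rootSet M), card_rootSet_trinomial hb]
  have hmem : ∀ x ∈ R, aeval x f = 0 := by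
    intro x hx
    rwa [hR, Set.Finite.mem_toFinset, mem_rootSet_trinomial] at hx
  have hmaps : ∀ x ∈ R.erase 0, x ^ (Nat.card K - 1) ∈
      (slopes (Nat.card K) 1 a b).image (algebraMap L M) := by
    intro x hx
    have hx0 := Finset.ne_of_mem_erase hx
    have hxf := hmem x (Finset.mem_of_mem_erase hx)
    obtain ⟨P, hP⟩ := h
    have hxq : aeval x ((additiveQuad (Nat.card L) 0 1 γ).map (algebraMap K L)) = 0 := by
      rw [hP, map_mul, hxf, zero_mul]
    rw [additiveQuad_map, aeval_additiveQuad] at hxq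
    simp only [map_zero, map_one, zero_mul, zero_add, one_mul] at hxq
    obtain ⟨u, hu, hux⟩ := exists_slope_of_eigenvector (c := -γ) hx0 hxf (by
      simp only [map_neg]
      linear_combination hxq)
    exact Finset.mem_image.mpr ⟨u, hu, hux⟩
  have hcard := Finset.card_le_mul_card_image_of_maps_to hmaps (Nat.card K - 1) (by
    intro w _
    refine (Finset.card_le_card (t := (nthRoots (Nat.card K - 1) w).toFinset) ?_).trans
      ((Multiset.toFinset_card_le _).trans (card_nthRoots _ _))
    intro x hx
    rw [Multiset.mem_toFinset, mem_nthRoots (by omega)]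
    exact (Finset.mem_filter.mp hx).2)
  rw [Finset.card_image_of_injective _ (algebraMap L M).injective] at hcard
  have h1 := Finset.pred_card_le_card_erase (s := R) (a := 0)
  rw [hRcard] at h1
  obtain ⟨k, hk⟩ : ∃ k, Nat.card K = k + 2 := ⟨_, (Nat.sub_add_cancel hr).symm⟩
  generalize (slopes (Nat.card K) 1 a b).card = N at hcard ⊢
  rw [hk] at h1 hcard ⊢
  have h2 : (k + 2) ^ 2 = (k + 1) * (k + 3) + 1 := by ring
  have h3 : (k + 1) * (k + 3) ≤ (k + 1) * N := by
    refine le_trans ?_ (h1.trans hcard)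
    omega
  exact Nat.le_of_mul_le_mul_left h3 (Nat.succ_pos k)

end Multiples

/-! ### The shape of f^* for each number of slopes -/

section Classification

variable {K L : Type*} [Field K] [Finite K] [Field L] [Finite L] [Algebra K L]

/-- The `K`-linear map `x ↦ x^{r^2} + a x^r + b x` on an extension of `L`. -/
noncomputable def trinomialMap (K : Type*) {L : Type*} [Field K] [Finite K] [Field L]
    (M : Type*) [Field M] [Algebra K M] [Algebra L M] (a b : L) : M →ₗ[K] M where
  toFun x := aeval x (additiveQuad (Nat.card K) 1 a b)
  map_add' x y := by
    simp only [aeval_additiveQuad, sq, pow_mul, add_pow_natCard K]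
    ring
  map_smul' c x := by
    simp only [aeval_additiveQuad, sq, pow_mul, Algebra.smul_def, mul_pow, algebraMap_pow_natCard,
      RingHom.id_apply]
    ring

/-- The `q`-th power map as a `K`-linear map. -/
noncomputable def frobeniusLinear (K L : Type*) [Field K] [Finite K] [Field L] [Finite L]
    [Algebra K L] (M : Type*) [Field M] [Algebra K M] : M →ₗ[K] M where
  toFun x := x ^ Nat.card L
  map_add' x y := add_pow_natCard_extension (K := K) L x y
  map_smul' c x := by
    rw [Algebra.smul_def, mul_pow, ← map_pow, pow_natCard_extension, RingHom.id_apply,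
      Algebra.smul_def]

/-- Cayley–Hamilton for the `q`-th power map on the roots of a trinomial. -/
theorem exists_quadratic_multiple {a b : L} (hb : b ≠ 0) :
    ∃ α β : K, additiveQuad (Nat.card K) 1 a b ∣
        (additiveQuad (Nat.card L) 1 α β).map (algebraMap K L) ∧
      ∀ c : K, c ^ 2 + α * c + β = 0 → (slopes (Nat.card K) 1 a b).Nonempty := by
  classical
  have hr : 1 < Nat.card K := Finite.one_lt_card
  have hq : 1 < Nat.card L := Finite.one_lt_card
  let M := AlgebraicClosure L
  set f := additiveQuad (Nat.card K) 1 a b with hf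
  let V : Submodule K M := LinearMap.ker (trinomialMap K M a b)
  have hVmem : ∀ x : M, x ∈ V ↔ aeval x f = 0 := fun x => Iff.rfl
  have hVset : (V : Set M) = f.rootSet M := by
    ext x
    rw [mem_rootSet_trinomial]
    exact hVmem x
  have hVfin : Finite V := by
    have := f.rootSet_finite M
    rw [← hVset] at this
    exact this
  have hVcard : Nat.card V = Nat.card K ^ 2 := by
    rw [← card_rootSet_trinomial hb (a := a), ← hf, ← hVset]
    rfl
  have hrank : Module.finrank K V = 2 := by
    rw [Module.natCard_eq_pow_finrank (K := K)] at hVcard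
    exact Nat.pow_right_injective hr hVcard
  -- The coefficients of f lie in L, so raising to the q-th power permutes the roots of f.
  have hstab : ∀ x ∈ V, frobeniusLinear K L M x ∈ V := by
    intro x hx
    rw [hVmem, hf, aeval_additiveQuad] at hx ⊢
    have := congrArg (· ^ Nat.card L) hx
    simp only [add_pow_natCard L, mul_pow, algebraMap_pow_natCard] at this
    rw [zero_pow (by omega), ← pow_mul, ← pow_mul, mul_comm _ (Nat.card L),
      mul_comm _ (Nat.card L), pow_mul, pow_mul] at this
    exact this
  let σ : Module.End K V := (frobeniusLinear K L M).restrict hstab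
  have hσ : ∀ x : V, ((σ x : V) : M) = (x : M) ^ Nat.card L := fun x => rfl
  have hdeg : σ.charpoly.natDegree = 2 := by rw [LinearMap.charpoly_natDegree, hrank]
  have hchar : σ.charpoly = X ^ 2 + C (σ.charpoly.coeff 1) * X + C (σ.charpoly.coeff 0) := by
    have hm : σ.charpoly.coeff 2 = 1 := by
      have := LinearMap.charpoly_monic σ
      rwa [Monic, leadingCoeff, hdeg] at this
    conv_lhs => rw [σ.charpoly.as_sum_range_C_mul_X_pow, hdeg]
    simp only [Finset.sum_range_succ, Finset.sum_range_zero, hm, C_1]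
    ring
  have hCH := LinearMap.aeval_self_charpoly σ
  refine ⟨σ.charpoly.coeff 1, σ.charpoly.coeff 0, ?_, ?_⟩
  · rw [hchar] at hCH
    have hroot : ∀ x : M, aeval x f = 0 →
        aeval x ((additiveQuad (Nat.card L) 1 (σ.charpoly.coeff 1)
          (σ.charpoly.coeff 0)).map (algebraMap K L)) = 0 := by
      intro x hx
      have h := congrArg (fun τ : Module.End K V => ((τ ⟨x, (hVmem x).mpr hx⟩ : V) : M)) hCH
      simp only [map_add, map_mul, aeval_X, aeval_C, LinearMap.add_apply,
        Module.algebraMap_end_apply, sq, Module.End.mul_apply, Submodule.coe_add,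
        Submodule.coe_smul, hσ, LinearMap.zero_apply, ZeroMemClass.coe_zero] at h
      simp only [Algebra.smul_def] at h
      rw [additiveQuad_map, aeval_additiveQuad, sq, pow_mul, map_one, map_one, one_mul,
        ← IsScalarTower.algebraMap_apply, ← IsScalarTower.algebraMap_apply]
      exact h
    -- The roots of f are simple, so inclusion of roots over the algebraic closure already gives
    -- divisibility.
    rw [← map_dvd_map' (algebraMap L M)]
    refine (IsAlgClosed.splits _).dvd_of_roots_le_roots
      (Polynomial.map_ne_zero (additiveQuad_monic hr _ _).ne_zero) ?_
    rw [Multiset.le_iff_subset (nodup_roots (trinomial_separable hb).map)]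
    intro x hx
    rw [mem_roots', IsRoot, eval_map_algebraMap] at hx ⊢
    refine ⟨Polynomial.map_ne_zero (Polynomial.map_ne_zero (additiveQuad_monic hq _ _).ne_zero),
      hroot x hx.2⟩
  · intro c hc
    have hroot : σ.charpoly.IsRoot c := by
      rw [hchar, IsRoot]
      simpa using hc
    rw [← Module.End.hasEigenvalue_iff_isRoot_charpoly] at hroot
    obtain ⟨x, hx⟩ := hroot.exists_hasEigenvector
    have hx0 : (x : M) ≠ 0 := fun h => hx.2 (Subtype.ext h)
    have hxc := congrArg (Subtype.val) hx.apply_eq_smul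
    rw [hσ, Submodule.coe_smul, Algebra.smul_def, IsScalarTower.algebraMap_apply K L M] at hxc
    obtain ⟨u, hu, -⟩ := exists_slope_of_eigenvector hx0 ((hVmem x).mp x.2) hxc
    exact ⟨u, hu⟩

theorem trinomial_ne_zero (a b : L) : additiveQuad (Nat.card K) 1 a b ≠ 0 :=
  (additiveQuad_monic Finite.one_lt_card _ _).ne_zero

theorem mclc_trinomial_natDegree (a b : L) :
    ∃ i, i ≠ 0 ∧ (mclc K (additiveQuad (Nat.card K) 1 a b)).natDegree = Nat.card L ^ i := by
  have hr : 1 < Nat.card K := Finite.one_lt_card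
  have h := (mclc_spec (K := K) (additiveQuad_mem 1 a b) (trinomial_ne_zero (K := K) a b)).1
  rw [isCentralLeftComposition_iff (additiveQuad_mem _ _ _) (trinomial_ne_zero a b)] at h
  obtain ⟨h1, h2, h3⟩ := h
  obtain ⟨i, hi⟩ := additivePolys_natDegree h1 h2.ne_zero
  refine ⟨i, ?_, hi⟩
  rintro rfl
  have := natDegree_le_of_dvd h3 (Polynomial.map_ne_zero h2.ne_zero)
  rw [natDegree_map, hi, additiveQuad_natDegree hr one_ne_zero] at this
  nlinarith

theorem mclc_trinomial_eq_linear {a b : L} {γ : K}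
    (h : additiveQuad (Nat.card K) 1 a b ∣
      (additiveQuad (Nat.card L) 0 1 γ).map (algebraMap K L)) :
    mclc K (additiveQuad (Nat.card K) 1 a b) = additiveQuad (Nat.card L) 0 1 γ := by
  have hq : 1 < Nat.card L := Finite.one_lt_card
  symm
  apply mclc_unique
  constructor
  · rw [isCentralLeftComposition_iff (additiveQuad_mem _ _ _) (trinomial_ne_zero a b)]
    exact ⟨additiveQuad_mem _ _ _, additiveQuad_monic_zero hq _, h⟩
  · intro G hG
    obtain ⟨i, hi0, hi⟩ := mclc_trinomial_natDegree (K := K) a b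
    have hle := (mclc_spec (K := K) (additiveQuad_mem 1 a b)
      (trinomial_ne_zero (K := K) a b)).2 G hG
    rw [additiveQuad_natDegree_zero hq one_ne_zero]
    rw [hi] at hle
    exact (Nat.le_self_pow hi0 _).trans hle

/-- A multiple of degree q^2 bounds the degree of f^* by q^2, leaving q or q^2; in the second case
the given multiple is minimal and uniqueness applies. -/
theorem mclc_trinomial_cases {a b : L} {α β : K}
    (h : additiveQuad (Nat.card K) 1 a b ∣
      (additiveQuad (Nat.card L) 1 α β).map (algebraMap K L)) :
    (∃ γ, mclc K (additiveQuad (Nat.card K) 1 a b) = additiveQuad (Nat.card L) 0 1 γ ∧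
      additiveQuad (Nat.card K) 1 a b ∣
        (additiveQuad (Nat.card L) 0 1 γ).map (algebraMap K L)) ∨
    mclc K (additiveQuad (Nat.card K) 1 a b) = additiveQuad (Nat.card L) 1 α β := by
  have hq : 1 < Nat.card L := Finite.one_lt_card
  have hspec := mclc_spec (K := K) (additiveQuad_mem 1 a b) (trinomial_ne_zero (K := K) a b)
  have hF : IsCentralLeftComposition (additiveQuad (Nat.card K) 1 a b)
      (additiveQuad (Nat.card L) 1 α β) := by
    rw [isCentralLeftComposition_iff (additiveQuad_mem _ _ _) (trinomial_ne_zero a b)]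
    exact ⟨additiveQuad_mem _ _ _, additiveQuad_monic hq _ _, h⟩
  obtain ⟨i, hi0, hi⟩ := mclc_trinomial_natDegree (K := K) a b
  have hle := hspec.2 _ hF
  rw [additiveQuad_natDegree hq one_ne_zero, hi, Nat.pow_le_pow_iff_right hq] at hle
  obtain rfl | rfl : i = 1 ∨ i = 2 := by omega
  · left
    have hcl := hspec.1
    rw [isCentralLeftComposition_iff (additiveQuad_mem _ _ _) (trinomial_ne_zero a b)] at hcl
    obtain ⟨h1, h2, h3⟩ := hcl
    rw [pow_one] at hi
    obtain ⟨δ, γ, -, hδ⟩ := eq_additiveQuad_of_natDegree hq h1 hi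
    rw [hδ] at h2 h3
    rw [hδ]
    rw [hδ] at hi
    rw [Monic, leadingCoeff, hi, additiveQuad_coeff_self hq] at h2
    subst h2
    exact ⟨γ, rfl, h3⟩
  · right
    symm
    apply mclc_unique
    refine ⟨hF, fun G hG => ?_⟩
    rw [additiveQuad_natDegree hq one_ne_zero, ← hi]
    exact hspec.2 G hG

theorem mclc_of_card_slopes_zero {a b : L} (h : (slopes (Nat.card K) 1 a b).card = 0) :
    ∃ α β : K, mclc K (additiveQuad (Nat.card K) 1 a b) = additiveQuad (Nat.card L) 1 α β ∧
      ∀ c : K, c ^ 2 + α * c + β ≠ 0 := by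
  rw [Finset.card_eq_zero] at h
  have hb : b ≠ 0 := by
    rintro rfl
    have : (0 : L) ∈ slopes (Nat.card K) 1 a 0 := by rw [mem_slopes]; simp
    rw [h] at this
    exact absurd this (Finset.notMem_empty _)
  obtain ⟨α, β, hd, hc⟩ := exists_quadratic_multiple (K := K) hb (a := a)
  refine ⟨α, β, ?_, fun c hc' => ?_⟩
  · rcases mclc_trinomial_cases hd with ⟨γ, -, hγ⟩ | h'
    · have := le_card_slopes_of_dvd hb hγ
      rw [h, Finset.card_empty] at this
      omega
    · exact h'
  · have := hc c hc'
    rw [h] at this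
    exact Finset.not_nonempty_empty this

theorem norm_left_factor {u v u' v' : L} (hne : u ≠ u')
    (ha : -u ^ Nat.card K - v = -u' ^ Nat.card K - v') (hb : u * v = u' * v') :
    Algebra.norm K v = Algebra.norm K u' :=
  (algebraMap K L).injective (embeddedNorm_left_factor hne ha hb)

theorem mclc_of_card_slopes_one {a b : L} (h : (slopes (Nat.card K) 1 a b).card = 1) :
    (a = 0 ∧ b = 0) ∨ ∃ c : K, c ≠ 0 ∧
      mclc K (additiveQuad (Nat.card K) 1 a b) =
        additiveQuad (Nat.card L) 1 (-(c + c)) (c * c) := by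
  have hr : 1 < Nat.card K := Finite.one_lt_card
  obtain ⟨u, hu⟩ := Finset.card_eq_one.mp h
  obtain ⟨v, rfl, rfl⟩ := exists_left_factor (K := K) (a := a) (b := b) (u := u) (by simp [hu])
  -- Unequal norms would give one shift, hence a second slope.
  have hN : Algebra.norm K v = Algebra.norm K u := by
    by_contra hne
    have := card_shifts_of_norm_ne (K := K) (u := u) (v := v)
      fun h => hne ((algebraMap K L).injective h).symm
    rw [card_slopes] at h
    omega
  by_cases hc : Algebra.norm K u = 0
  · left
    rw [hc] at hN
    rw [Algebra.norm_eq_zero_iff] at hc hN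
    subst hc hN
    simp [(zero_lt_one.trans hr).ne']
  · right
    refine ⟨_, hc, ?_⟩
    have hd := trinomial_dvd_norm_product (K := K) u v
    rw [hN] at hd
    rcases mclc_trinomial_cases hd with ⟨γ, -, hγ⟩ | h'
    · have hb : u * v ≠ 0 := by
        refine mul_ne_zero ?_ ?_
        · rwa [Ne, ← Algebra.norm_eq_zero_iff (R := K)]
        · rwa [Ne, ← Algebra.norm_eq_zero_iff (R := K), hN]
      have := le_card_slopes_of_dvd hb hγ
      omega
    · exact h'

theorem mclc_of_card_slopes_two {a b : L} (h : (slopes (Nat.card K) 1 a b).card = 2) :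
    ∃ c d : K, c ≠ d ∧ mclc K (additiveQuad (Nat.card K) 1 a b) =
        additiveQuad (Nat.card L) 1 (-(c + d)) (c * d) := by
  classical
  have hr : 1 < Nat.card K := Finite.one_lt_card
  obtain ⟨u, u', hne, hs⟩ := Finset.card_eq_two.mp h
  have hu : u ∈ slopes (Nat.card K) 1 a b := by simp [hs]
  have hu' : u' ∈ slopes (Nat.card K) 1 a b := by simp [hs]
  obtain ⟨v, rfl, rfl⟩ := exists_left_factor (K := K) hu
  obtain ⟨v', ha, hb⟩ := exists_left_factor (K := K) hu'
  have h1 := norm_left_factor (K := K) hne ha hb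
  have h2 := norm_left_factor (K := K) hne.symm ha.symm hb.symm
  -- Equal norms would put f below a central multiple of degree q and force r+1 > 2 slopes.
  have hN : Algebra.norm K u ≠ Algebra.norm K u' := by
    intro hN
    have hd := trinomial_dvd_linear (K := K) ha hb hne (h1.trans hN.symm) h2
    have hu0 : u ≠ 0 := by
      rintro rfl
      rw [Algebra.norm_zero, eq_comm, Algebra.norm_eq_zero_iff] at hN
      exact hne hN.symm
    have hv0 : v ≠ 0 := by
      rw [Ne, ← Algebra.norm_eq_zero_iff (R := K), h1, ← hN, Algebra.norm_eq_zero_iff]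
      exact hu0
    have := le_card_slopes_of_dvd (mul_ne_zero hu0 hv0) hd
    omega
  refine ⟨_, _, hN, ?_⟩
  have hd := trinomial_dvd_norm_product (K := K) u v
  rw [h1] at hd
  rcases mclc_trinomial_cases hd with ⟨γ, -, hγ⟩ | h'
  · exact absurd ((norm_eq_of_trinomial_dvd hu hγ).trans (norm_eq_of_trinomial_dvd hu' hγ).symm) hN
  · exact h'

theorem mclc_of_card_slopes_gt_two {a b : L} (h : 2 < (slopes (Nat.card K) 1 a b).card) :
    ∃ c : K, c ≠ 0 ∧
      mclc K (additiveQuad (Nat.card K) 1 a b) = additiveQuad (Nat.card L) 0 1 c := by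
  obtain ⟨u, hu, u', hu', u'', hu'', h1, h2, h3⟩ := Finset.two_lt_card.mp h
  obtain ⟨v, rfl, rfl⟩ := exists_left_factor (K := K) hu
  obtain ⟨v', ha', hb'⟩ := exists_left_factor (K := K) hu'
  obtain ⟨v'', ha'', hb''⟩ := exists_left_factor (K := K) hu''
  have e1 := norm_left_factor (K := K) h1 ha' hb'
  have e2 := norm_left_factor (K := K) h2 ha'' hb''
  have e3 := norm_left_factor (K := K) h3 (ha'.symm.trans ha'') (hb'.symm.trans hb'')
  have hd := trinomial_dvd_linear (K := K) ha' hb' h1 e2 e3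
  refine ⟨_, ?_, mclc_trinomial_eq_linear hd⟩
  rw [neg_ne_zero]
  intro hz
  have hz' : Algebra.norm K u' = 0 := by rw [← e1, e2, hz]
  rw [Algebra.norm_eq_zero_iff] at hz hz'
  exact h3 (hz'.trans hz.symm)

/-- The minimal central left composition of `x^{r^2}` is `x^q` or `x^{q^2}`. -/
theorem mclc_X_pow (K L : Type*) [Field K] [Finite K] [Field L] [Finite L] [Algebra K L] :
    mclc K (additiveQuad (Nat.card K) 1 (0 : L) 0) = additiveQuad (Nat.card L) 0 1 0 ∨
      mclc K (additiveQuad (Nat.card K) 1 (0 : L) 0) = additiveQuad (Nat.card L) 1 0 0 := by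
  have hr : Nat.card K ≠ 0 := Nat.card_pos.ne'
  have hd := trinomial_dvd_norm_product (K := K) (0 : L) 0
  have h0 : (0 : L) ∈ slopes (Nat.card K) 1 0 0 := by rw [mem_slopes]; simp
  simp only [Algebra.norm_zero, add_zero, neg_zero, mul_zero, zero_pow hr, sub_zero] at hd
  rcases mclc_trinomial_cases hd with ⟨γ, hγ, hγd⟩ | h
  · have := norm_eq_of_trinomial_dvd h0 hγd
    rw [Algebra.norm_zero, eq_comm, neg_eq_zero] at this
    rw [this] at hγ
    exact Or.inl hγ
  · exact Or.inr h

end Classification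

/-! ### Translation to collision sets -/

section Collisions

variable {K L : Type*} [Field K] [Finite K] [Field L] [Finite L] [Algebra K L]

theorem card_slopes_zero_zero (r : ℕ) : (slopes r 1 (0 : L) 0).card = 1 := by
  rw [Finset.card_eq_one]
  refine ⟨0, ?_⟩
  ext u
  simp [mem_slopes]

/-- The alternatives for f^* are told apart by degree and by roots of τ(f^*) in K, so each
equivalence below follows by discarding the incompatible ones. -/
theorem trinomial_cases (a b : L) :
    ((slopes (Nat.card K) 1 a b).card = 0 ∧ ∃ α β : K,
      mclc K (additiveQuad (Nat.card K) 1 a b) = additiveQuad (Nat.card L) 1 α β ∧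
        ∀ c : K, c ^ 2 + α * c + β ≠ 0) ∨
    ((slopes (Nat.card K) 1 a b).card = 1 ∧ a = 0 ∧ b = 0 ∧
      (mclc K (additiveQuad (Nat.card K) 1 a b) = additiveQuad (Nat.card L) 0 1 0 ∨
        mclc K (additiveQuad (Nat.card K) 1 a b) = additiveQuad (Nat.card L) 1 0 0)) ∨
    ((slopes (Nat.card K) 1 a b).card = 1 ∧ ∃ c : K, c ≠ 0 ∧
      mclc K (additiveQuad (Nat.card K) 1 a b) =
        additiveQuad (Nat.card L) 1 (-(c + c)) (c * c)) ∨
    ((slopes (Nat.card K) 1 a b).card = 2 ∧ ∃ c d : K, c ≠ d ∧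
      mclc K (additiveQuad (Nat.card K) 1 a b) =
        additiveQuad (Nat.card L) 1 (-(c + d)) (c * d)) ∨
    ((slopes (Nat.card K) 1 a b).card = Nat.card K + 1 ∧ ∃ c : K, c ≠ 0 ∧
      mclc K (additiveQuad (Nat.card K) 1 a b) = additiveQuad (Nat.card L) 0 1 c) := by
  have hr : 1 < Nat.card K := Finite.one_lt_card
  rcases card_slopes_cases K a b with h | h | h | h
  · exact Or.inl ⟨h, mclc_of_card_slopes_zero h⟩
  · rcases mclc_of_card_slopes_one h with ⟨rfl, rfl⟩ | h'
    · exact Or.inr (Or.inl ⟨h, rfl, rfl, mclc_X_pow K L⟩)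
    · exact Or.inr (Or.inr (Or.inl ⟨h, h'⟩))
  · exact Or.inr (Or.inr (Or.inr (Or.inl ⟨h, mclc_of_card_slopes_two h⟩)))
  · exact Or.inr (Or.inr (Or.inr (Or.inr ⟨h, mclc_of_card_slopes_gt_two (by omega)⟩)))

theorem card_slopes_eq_zero_iff (a b : L) :
    (slopes (Nat.card K) 1 a b).card = 0 ↔ ∃ α β : K,
      mclc K (additiveQuad (Nat.card K) 1 a b) = additiveQuad (Nat.card L) 1 α β ∧
        ∀ c : K, c ^ 2 + α * c + β ≠ 0 := by
  have hq : 1 < Nat.card L := Finite.one_lt_card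
  refine ⟨mclc_of_card_slopes_zero, ?_⟩
  rintro ⟨α, β, hF, hc⟩
  rcases trinomial_cases (K := K) a b with h | ⟨-, -, -, h | h⟩ | ⟨-, c, -, h⟩ | ⟨-, c, d, -, h⟩ |
    ⟨-, c, -, h⟩
  · exact h.1
  all_goals
    exfalso
    rw [hF, additiveQuad_inj hq] at h
  · exact one_ne_zero h.1
  · obtain ⟨-, rfl, rfl⟩ := h
    exact hc 0 (by ring)
  · obtain ⟨-, rfl, rfl⟩ := h
    exact hc c (by ring)
  · obtain ⟨-, rfl, rfl⟩ := h
    exact hc c (by ring)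
  · exact one_ne_zero h.1

theorem card_slopes_eq_one_iff (a b : L) :
    (slopes (Nat.card K) 1 a b).card = 1 ↔ (∃ c : K, c ≠ 0 ∧
      mclc K (additiveQuad (Nat.card K) 1 a b) =
        additiveQuad (Nat.card L) 1 (-(c + c)) (c * c)) ∨ (a = 0 ∧ b = 0) := by
  have hq : 1 < Nat.card L := Finite.one_lt_card
  refine ⟨fun h => (mclc_of_card_slopes_one h).symm, ?_⟩
  rintro (⟨e, -, hF⟩ | ⟨rfl, rfl⟩)
  swap
  · exact card_slopes_zero_zero _
  rcases trinomial_cases (K := K) a b with ⟨-, α, β, h, hn⟩ | h | h | ⟨-, c, d, hcd, h⟩ |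
    ⟨-, c, -, h⟩
  · exfalso
    rw [hF, additiveQuad_inj hq] at h
    obtain ⟨-, rfl, rfl⟩ := h
    exact hn e (by ring)
  · exact h.1
  · exact h.1
  · exfalso
    rw [hF, additiveQuad_inj hq] at h
    obtain ⟨-, h1, h2⟩ := h
    -- Comparing the two factorizations at c and at d avoids dividing by 2 and so covers
    -- characteristic 2.
    have h3 : (e - c) ^ 2 = 0 := by linear_combination h2 + c * h1
    have h4 : (e - d) ^ 2 = 0 := by linear_combination h2 + d * h1
    rw [sq_eq_zero_iff, sub_eq_zero] at h3 h4
    exact hcd (h3.symm.trans h4)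
  · exfalso
    rw [hF, additiveQuad_inj hq] at h
    exact one_ne_zero h.1

theorem card_slopes_eq_two_iff (a b : L) :
    (slopes (Nat.card K) 1 a b).card = 2 ↔ ∃ c d : K, c ≠ d ∧
      mclc K (additiveQuad (Nat.card K) 1 a b) =
        additiveQuad (Nat.card L) 1 (-(c + d)) (c * d) := by
  have hq : 1 < Nat.card L := Finite.one_lt_card
  refine ⟨mclc_of_card_slopes_two, ?_⟩
  rintro ⟨c, d, hcd, hF⟩
  have hdouble : ∀ e : K, -(c + d) = -(e + e) → c * d = e * e → False := by
    intro e h1 h2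
    have h3 : (e - c) ^ 2 = 0 := by linear_combination -h2 - c * h1
    have h4 : (e - d) ^ 2 = 0 := by linear_combination -h2 - d * h1
    rw [sq_eq_zero_iff, sub_eq_zero] at h3 h4
    exact hcd (h3.symm.trans h4)
  rcases trinomial_cases (K := K) a b with ⟨-, α, β, h, hn⟩ | ⟨-, -, -, h | h⟩ | ⟨-, e, -, h⟩ | h |
    ⟨-, e, -, h⟩
  · exfalso
    rw [hF, additiveQuad_inj hq] at h
    obtain ⟨-, rfl, rfl⟩ := h
    exact hn c (by ring)
  · rw [hF, additiveQuad_inj hq] at h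
    exact absurd h.1 one_ne_zero
  · rw [hF, additiveQuad_inj hq] at h
    exact (hdouble 0 (by rw [h.2.1]; ring) (by rw [h.2.2]; ring)).elim
  · rw [hF, additiveQuad_inj hq] at h
    exact (hdouble e h.2.1 h.2.2).elim
  · exact h.1
  · rw [hF, additiveQuad_inj hq] at h
    exact absurd h.1 one_ne_zero

theorem card_slopes_eq_card_add_one_iff (a b : L) :
    (slopes (Nat.card K) 1 a b).card = Nat.card K + 1 ↔ ∃ c : K, c ≠ 0 ∧
      mclc K (additiveQuad (Nat.card K) 1 a b) = additiveQuad (Nat.card L) 0 1 c := by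
  have hr : 1 < Nat.card K := Finite.one_lt_card
  have hq : 1 < Nat.card L := Finite.one_lt_card
  refine ⟨fun h => mclc_of_card_slopes_gt_two (by omega), ?_⟩
  rintro ⟨e, he, hF⟩
  rcases trinomial_cases (K := K) a b with ⟨-, α, β, h, -⟩ | ⟨-, -, -, h | h⟩ | ⟨-, c, -, h⟩ |
    ⟨-, c, d, -, h⟩ | h
  · rw [hF, additiveQuad_inj hq] at h
    exact absurd h.1 zero_ne_one
  · rw [hF, additiveQuad_inj hq] at h
    exact absurd h.2.2 he
  · rw [hF, additiveQuad_inj hq] at h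
    exact absurd h.1 zero_ne_one
  · rw [hF, additiveQuad_inj hq] at h
    exact absurd h.1 zero_ne_one
  · rw [hF, additiveQuad_inj hq] at h
    exact absurd h.1 zero_ne_one
  · exact h.1

theorem mclc_trinomial_form (a b : L) :
    (∃ γ : K, mclc K (additiveQuad (Nat.card K) 1 a b) = additiveQuad (Nat.card L) 0 1 γ) ∨
      ∃ α β : K, mclc K (additiveQuad (Nat.card K) 1 a b) = additiveQuad (Nat.card L) 1 α β := by
  rcases trinomial_cases (K := K) a b with ⟨-, α, β, h, -⟩ | ⟨-, -, -, h | h⟩ | ⟨-, c, -, h⟩ |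
    ⟨-, c, d, -, h⟩ | ⟨-, c, -, h⟩
  · exact Or.inr ⟨_, _, h⟩
  · exact Or.inl ⟨_, h⟩
  · exact Or.inr ⟨_, _, h⟩
  · exact Or.inr ⟨_, _, h⟩
  · exact Or.inr ⟨_, _, h⟩
  · exact Or.inl ⟨_, h⟩

theorem additiveQuad_comp_central (g₁ g₀ h₁ h₀ : K) :
    (additiveQuad (Nat.card L) 0 g₁ g₀).comp (additiveQuad (Nat.card L) 0 h₁ h₀) =
      additiveQuad (Nat.card L) (g₁ * h₁) (g₁ * h₀ + g₀ * h₁) (g₀ * h₀) := by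
  rw [additiveQuad_comp (add_pow_natCard_extension (K := K) L), pow_natCard_extension,
    pow_natCard_extension]

/-- A central polynomial of degree `q^2` is a composition of two central polynomials of degree `q`
if and only if its image under `τ` has a root. -/
theorem exists_comp_iff_root (α β : K) :
    (∃ g ∈ additivePolys K (Nat.card L), ∃ h ∈ additivePolys K (Nat.card L),
      g.natDegree = Nat.card L ∧ h.natDegree = Nat.card L ∧
        additiveQuad (Nat.card L) 1 α β = g.comp h) ↔ ∃ c : K, c ^ 2 + α * c + β = 0 := by
  have hq : 1 < Nat.card L := Finite.one_lt_card
  constructor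
  · rintro ⟨g, hg, h, hh, hgd, hhd, hc⟩
    obtain ⟨g₁, g₀, -, rfl⟩ := eq_additiveQuad_of_natDegree hq hg hgd
    obtain ⟨h₁, h₀, h1, rfl⟩ := eq_additiveQuad_of_natDegree hq hh hhd
    rw [additiveQuad_comp_central, additiveQuad_inj hq] at hc
    obtain ⟨e1, rfl, rfl⟩ := hc
    refine ⟨-h₀ / h₁, ?_⟩
    field_simp
    linear_combination h₀ ^ 2 * e1
  · rintro ⟨c, hc⟩
    refine ⟨additiveQuad (Nat.card L) 0 1 (α + c), additiveQuad_mem _ _ _,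
      additiveQuad (Nat.card L) 0 1 (-c), additiveQuad_mem _ _ _,
      additiveQuad_natDegree_zero hq one_ne_zero _, additiveQuad_natDegree_zero hq one_ne_zero _,
      ?_⟩
    rw [additiveQuad_comp_central, additiveQuad_inj hq]
    refine ⟨by ring, by ring, by linear_combination hc⟩

/-- Monicity is carried along because g and h need not be monic; c and d are the roots of τ(g) and
τ(h). -/
theorem exists_coprime_comp_iff (F : K[X]) :
    (∃ g ∈ additivePolys K (Nat.card L), ∃ h ∈ additivePolys K (Nat.card L),
      g.natDegree = Nat.card L ∧ h.natDegree = Nat.card L ∧ IsCompCoprime (Nat.card L) g h ∧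
        F = g.comp h) ∧ F.Monic ↔
      ∃ c d : K, c ≠ d ∧ F = additiveQuad (Nat.card L) 1 (-(c + d)) (c * d) := by
  have hq : 1 < Nat.card L := Finite.one_lt_card
  constructor
  · rintro ⟨⟨g, hg, h, hh, hgd, hhd, hcop, rfl⟩, hm⟩
    obtain ⟨g₁, g₀, hg1, rfl⟩ := eq_additiveQuad_of_natDegree hq hg hgd
    obtain ⟨h₁, h₀, hh1, rfl⟩ := eq_additiveQuad_of_natDegree hq hh hhd
    rw [additiveQuad_comp_central] at hm ⊢
    rw [Monic, leadingCoeff, additiveQuad_natDegree hq (mul_ne_zero hg1 hh1),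
      additiveQuad_coeff_sq hq] at hm
    refine ⟨-g₀ / g₁, -h₀ / h₁, ?_, ?_⟩
    · intro heq
      -- If the roots agree, g and h are scalar multiples of x^q + (h₀/h₁)x, a common right
      -- component of degree q.
      have := hcop (additiveQuad (Nat.card L) 0 1 (h₀ / h₁)) (additiveQuad_mem _ _ _)
        (additiveQuad (Nat.card L) 0 0 g₁) (additiveQuad_mem _ _ _)
        (additiveQuad (Nat.card L) 0 0 h₁) (additiveQuad_mem _ _ _) ?_ ?_
      · rw [additiveQuad_natDegree_zero hq one_ne_zero] at this
        omega
      · rw [additiveQuad_comp_central, additiveQuad_inj hq]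
        refine ⟨by ring, by ring, ?_⟩
        field_simp at heq ⊢
        linear_combination -heq
      · rw [additiveQuad_comp_central, additiveQuad_inj hq]
        refine ⟨by ring, by ring, ?_⟩
        field_simp
    · rw [additiveQuad_inj hq]
      refine ⟨hm, ?_, ?_⟩
      · field_simp
        linear_combination (g₁ * h₀ + g₀ * h₁) * hm
      · field_simp
        linear_combination (g₀ * h₀) * hm
  · rintro ⟨c, d, hcd, rfl⟩
    refine ⟨⟨additiveQuad (Nat.card L) 0 1 (-c), additiveQuad_mem _ _ _,
      additiveQuad (Nat.card L) 0 1 (-d), additiveQuad_mem _ _ _,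
      additiveQuad_natDegree_zero hq one_ne_zero _, additiveQuad_natDegree_zero hq one_ne_zero _,
      ?_, ?_⟩, additiveQuad_monic hq _ _⟩
    · intro u _ v _ w _ hv hw
      -- A common right component is also one of the difference of g and h, which has degree 1.
      have hdiff : (v - w).comp u = C (d - c) * X := by
        rw [sub_comp, ← hv, ← hw, additiveQuad, additiveQuad]
        simp only [C_neg, C_sub]
        ring
      have := congrArg natDegree hdiff
      rw [natDegree_comp, natDegree_C_mul (sub_ne_zero.mpr hcd.symm), natDegree_X] at this
      exact Nat.eq_one_of_mul_eq_one_left this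
    · rw [additiveQuad_comp_central, additiveQuad_inj hq]
      refine ⟨by ring, by ring, by ring⟩

theorem irreducible_tau_iff (α β : K) :
    (Irreducible (tau (Nat.card L) (additiveQuad (Nat.card L) 1 α β)) ∧
      (tau (Nat.card L) (additiveQuad (Nat.card L) 1 α β)).natDegree = 2) ↔
      ∀ c : K, c ^ 2 + α * c + β ≠ 0 := by
  have hq : 1 < Nat.card L := Finite.one_lt_card
  rw [tau_additiveQuad hq one_ne_zero]
  have hd : (C 1 * X ^ 2 + C α * X + C β : K[X]).natDegree = 2 := natDegree_quadratic one_ne_zero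
  rw [irreducible_iff_roots_eq_zero_of_degree_le_three hd.ge (by omega)]
  constructor
  · rintro ⟨h, -⟩ c hc
    have hm : c ∈ (C 1 * X ^ 2 + C α * X + C β : K[X]).roots := by
      rw [mem_roots (ne_zero_of_natDegree_gt (n := 0) (by omega))]
      simpa using hc
    rw [h] at hm
    exact absurd hm (Multiset.notMem_zero _)
  · intro h
    refine ⟨Multiset.eq_zero_of_forall_notMem fun c hc => h c ?_, hd⟩
    simpa using (mem_roots'.mp hc).2

theorem mem_monicAdditiveSq {m : ℕ} (hm : 1 < m) {f : L[X]} :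
    f ∈ monicAdditiveSq L m ↔ ∃ a b, f = additiveQuad m 1 a b := by
  constructor
  · rintro ⟨h1, h2, h3⟩
    obtain ⟨α, a, b, -, rfl⟩ := eq_additiveQuad_of_natDegree_sq hm h1 h3
    rw [Monic, leadingCoeff, h3, additiveQuad_coeff_sq hm] at h2
    subst h2
    exact ⟨a, b, rfl⟩
  · rintro ⟨a, b, rfl⟩
    exact ⟨additiveQuad_mem _ _ _, additiveQuad_monic hm _ _,
      additiveQuad_natDegree hm one_ne_zero _ _⟩

theorem image_collisionSet {i : ℕ} {P : L[X] → Prop}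
    (hP : ∀ a b : L, (slopes (Nat.card K) 1 a b).card = i ↔ P (additiveQuad (Nat.card K) 1 a b)) :
    additiveTrinomial (Nat.card K) '' collisionSet L (Nat.card K) i =
      {f | f ∈ monicAdditiveSq L (Nat.card K) ∧ P f} := by
  have hr : 1 < Nat.card K := Finite.one_lt_card
  ext f
  constructor
  · rintro ⟨ab, hab, rfl⟩
    have h : HasMaximalCollision (Nat.card K) (additiveTrinomial (Nat.card K) ab) i := hab
    rw [additiveTrinomial_eq] at h ⊢
    rw [hasMaximalCollision_iff one_ne_zero] at h
    exact ⟨(mem_monicAdditiveSq hr).mpr ⟨_, _, rfl⟩, (hP _ _).mp h.symm⟩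
  · rintro ⟨hf, hPf⟩
    obtain ⟨a, b, rfl⟩ := (mem_monicAdditiveSq hr).mp hf
    refine ⟨(a, b), ?_, additiveTrinomial_eq _⟩
    change HasMaximalCollision (Nat.card K) (additiveTrinomial (Nat.card K) (a, b)) i
    rw [additiveTrinomial_eq, hasMaximalCollision_iff one_ne_zero]
    exact ((hP _ _).mpr hPf).symm

theorem ncard_collisionSet (K L : Type*) [Field K] [Finite K] [Field L] [Fintype L] [Algebra K L]
    (i : ℕ) : (collisionSet L (Nat.card K) i).ncard = slopeCount K L i := by
  classical
  rw [slopeCount, ← Set.ncard_coe_finset]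
  congr 1
  ext ab
  simp only [Finset.coe_filter, Finset.mem_univ, true_and]
  change HasMaximalCollision (Nat.card K) (additiveTrinomial (Nat.card K) ab) i ↔ _ = i
  rw [additiveTrinomial_eq, hasMaximalCollision_iff one_ne_zero, eq_comm]

end Collisions

theorem mainTheorem5 (r q : ℕ) (K L : Type*) [Field K] [Finite K] [Field L] [Finite L]
    [Algebra K L] (hr : Nat.card K = r) (hq : Nat.card L = q) :
    -- Case 0
    (additiveTrinomial r '' collisionSet L r 0 =
        {f | f ∈ monicAdditiveSq L r ∧ (mclc K f).natDegree = q ^ 2 ∧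
          ¬ ∃ g ∈ additivePolys K q, ∃ h ∈ additivePolys K q,
            g.natDegree = q ∧ h.natDegree = q ∧ mclc K f = g.comp h} ∧
      additiveTrinomial r '' collisionSet L r 0 =
        {f | f ∈ monicAdditiveSq L r ∧ Irreducible (tau q (mclc K f)) ∧
          (tau q (mclc K f)).natDegree = 2} ∧
      ((collisionSet L r 0).ncard : ℚ) = r * ((q : ℚ) ^ 2 - 1) / (2 * (r + 1))) ∧
    -- Case 1
    (additiveTrinomial r '' collisionSet L r 1 =
        {f | f ∈ monicAdditiveSq L r ∧ ∃ c : K, c ≠ 0 ∧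
          mclc K f = (X ^ q - C c * X).comp (X ^ q - C c * X)} ∪ {X ^ (r ^ 2)} ∧
      ((collisionSet L r 1).ncard : ℚ) = ((q : ℚ) ^ 2 - q) / r + 1) ∧
    -- Case 2
    (additiveTrinomial r '' collisionSet L r 2 =
        {f | f ∈ monicAdditiveSq L r ∧
          ∃ g ∈ additivePolys K q, ∃ h ∈ additivePolys K q,
            g.natDegree = q ∧ h.natDegree = q ∧ IsCompCoprime q g h ∧
              mclc K f = g.comp h} ∧
      ((collisionSet L r 2).ncard : ℚ) =
        ((q : ℚ) - 1) ^ 2 * (r - 2) / (2 * (r - 1)) + q - 1) ∧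
    -- Case r + 1
    (additiveTrinomial r '' collisionSet L r (r + 1) =
        {f | f ∈ monicAdditiveSq L r ∧ ∃ c : K, c ≠ 0 ∧ mclc K f = X ^ q + C c * X} ∧
      ((collisionSet L r (r + 1)).ncard : ℚ) =
        ((q : ℚ) - 1) * (q - r) / (r * ((r : ℚ) ^ 2 - 1))) ∧
    -- no other collision sizes occur
    (collisionSet L r 0).ncard + (collisionSet L r 1).ncard + (collisionSet L r 2).ncard +
        (collisionSet L r (r + 1)).ncard = q ^ 2 ∧
    (∀ f ∈ additivePolys L r, f.natDegree = r ^ 2 →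
      ∀ i : ℕ, HasMaximalCollision r f i → i = 0 ∨ i = 1 ∨ i = 2 ∨ i = r + 1) := by
  subst hr hq
  have := Fintype.ofFinite L
  have hr : 1 < Nat.card K := Finite.one_lt_card
  have hq : 1 < Nat.card L := Finite.one_lt_card
  obtain ⟨n0, n1, n2, n3⟩ := slopeCount_formulas K L rfl
    (congrArg Nat.cast (Nat.card_eq_fintype_card (α := L)))
  simp only [← ncard_collisionSet] at n0 n1 n2 n3
  refine ⟨⟨image_collisionSet fun a b => ?_, image_collisionSet fun a b => ?_, n0⟩, ⟨?_, n1⟩,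
    ⟨image_collisionSet fun a b => ?_, n2⟩, ⟨image_collisionSet fun a b => ?_, n3⟩, ?_, ?_⟩
  · rw [card_slopes_eq_zero_iff]
    constructor
    · rintro ⟨α, β, h, hc⟩
      rw [h]
      refine ⟨additiveQuad_natDegree hq one_ne_zero _ _, ?_⟩
      rw [exists_comp_iff_root]
      exact fun ⟨c, hc'⟩ => hc c hc'
    · rintro ⟨hd, hn⟩
      rcases mclc_trinomial_form (K := K) a b with ⟨γ, h⟩ | ⟨α, β, h⟩
      · rw [h, additiveQuad_natDegree_zero hq one_ne_zero] at hd
        nlinarith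
      · rw [h, exists_comp_iff_root] at hn
        exact ⟨α, β, h, fun c hc => hn ⟨c, hc⟩⟩
  · rw [card_slopes_eq_zero_iff]
    constructor
    · rintro ⟨α, β, h, hc⟩
      rw [h]
      exact (irreducible_tau_iff α β).mpr hc
    · intro hi
      rcases mclc_trinomial_form (K := K) a b with ⟨γ, h⟩ | ⟨α, β, h⟩
      -- A linear τ(f^*) is irreducible as well; only the degree condition excludes it.
      · rw [h, tau_additiveQuad_zero hq one_ne_zero, natDegree_linear one_ne_zero] at hi
        exact absurd hi.2 (by norm_num)
      · rw [h] at hi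
        exact ⟨α, β, h, (irreducible_tau_iff α β).mp hi⟩
  · have hX : (X : L[X]) ^ (Nat.card K ^ 2) = additiveQuad (Nat.card K) 1 0 0 := by
      simp [additiveQuad]
    have hlin : ∀ c : K, (X ^ Nat.card L - C c * X : K[X]) = additiveQuad (Nat.card L) 0 1 (-c) := by
      intro c
      simp [additiveQuad, sub_eq_add_neg]
    rw [image_collisionSet (K := K) (P := fun f => (∃ c : K, c ≠ 0 ∧ mclc K f =
      (X ^ Nat.card L - C c * X).comp (X ^ Nat.card L - C c * X)) ∨ f = X ^ (Nat.card K ^ 2))]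
    · ext f
      simp only [Set.mem_union, Set.mem_ofPred_eq, Set.mem_singleton_iff, and_or_left]
      refine or_congr_right (and_iff_right_of_imp ?_)
      rintro rfl
      exact (mem_monicAdditiveSq hr).mpr ⟨0, 0, hX⟩
    · intro a b
      rw [card_slopes_eq_one_iff (K := K), hX, additiveQuad_inj hr, eq_self_iff_true, true_and]
      refine or_congr_left (exists_congr fun c => and_congr_right fun _ => ?_)
      rw [hlin, additiveQuad_comp_central]
      ring_nf
  · rw [card_slopes_eq_two_iff, ← exists_coprime_comp_iff, and_iff_left]
    exact (mclc_spec (K := K) (additiveQuad_mem 1 a b) (trinomial_ne_zero (K := K) a b)).1.monic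
  · rw [card_slopes_eq_card_add_one_iff]
    simp [additiveQuad]
  · simp only [ncard_collisionSet, Nat.card_eq_fintype_card (α := L)]
    exact sum_slopeCount K L
  · intro f hf hd i hi
    obtain ⟨α, β, γ, hα, rfl⟩ := eq_additiveQuad_of_natDegree_sq hr hf hd
    -- Dividing by the leading coefficient keeps the slopes and reduces to the monic case.
    rw [hasMaximalCollision_iff hα, slopes_div hα] at hi
    rw [hi]
    exact card_slopes_cases K _ _
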